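/- Let $\mathbb L$ be a finite or countably infinite set and $n\ge 0$. For $k\in\mathbb L$ let $\Lambda_k\in\mathbb H$, put $\lambda_k=-\tfrac12\overline{\Lambda_k}\,i\,\Lambda_k\in\operatorname{Im}\mathbb H$, and let $u_k\in\mathbb Z^n$ be non-zero and primitive, such that the $u_k$ span $\mathbb R^n$ and $\sum_k(1+|\lambda_k|)^{-1}<\infty$. Let $M_\Lambda=\Lambda+L^2(\mathbb H)\subset\mathbb H^{\mathbb L}$ with the topology of the $L^2$-metric, let $T_\lambda=\{g\in(S^1)^{\mathbb L}:\sum_k(1+|\lambda_k|)|1-g_k|^2<\infty\}$ act on $M_\Lambda$ by $(gx)_k=g_kx_k$, and let $\mathfrak t_\lambda=\{t\in\mathbb R^{\mathbb L}:\sum_k(1+|\lambda_k|)t_k^2<\infty\}$ with its Hilbert norm. Write $(e_k)$ for the standard vectors of $\mathfrak t_\lambda$, and let $\mu_\Lambda(x)=\sum_k(\lambda_k+\tfrac12\overline{x_k}\,i\,x_k)e_k^*\in\operatorname{Im}\mathbb H\otimes\mathfrak t_\lambda^*$ for $x\in M_\Lambda$. Let $H_k=\{a\in\operatorname{Im}\mathbb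 H\otimes(\mathbb R^n)^*: a(u_k)=\lambda_k\}$. Given a continuous linear map $\beta:\mathfrak t_\lambda\to\mathbb R^n$ with $\beta(e_k)=u_k$ for all $k$, let $N_\beta=\ker(\exp\circ\beta\circ\exp^{-1}:T_\lambda\to T^n)$ and let $\mu_\beta$ be $\mu_\Lambda$ restricted to $\ker\beta$. Let $M=M(\beta,\lambda)=\mu_\beta^{-1}(0)/N_\beta$ with the quotient topology. The torus $T^n\cong T_\lambda/N_\beta$ acts on $M$. On $\mu_\beta^{-1}(0)$ the form $\mu_\Lambda(x)$ vanishes on $\ker\beta$, so it defines an element of $\operatorname{Im}\mathbb H\otimes(\mathfrak t_\lambda/\ker\beta)^*=\operatorname{Im}\mathbb H\otimes(\mathbb R^n)^*$; let $\phi:M\to\operatorname{Im}\mathbb H\otimes(\mathbb R^n)^*$ be the induced map (the hyperkähler moment map of the $T^n$-action). (0) If, whenever $n$ distinct flats $H_{k(1)},\dots,H_{k(n)}$ have a common point, $u_{k(1)},\dots,u_{k(n)}$ is a $\mathbb Z$-basis of $\mathbb Z^n$, then a continuous $\beta$ as above exists, so that $M(\beta,\lambda)$ is defined. For every continuous $\beta$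 as above: (1) $\phi$ induces a homeomorphism $M/T^n\to\operatorname{Im}\mathbb H\otimes(\mathbb R^n)^*$, and $\operatorname{Im}\mathbb H\otimes(\mathbb R^n)^*\cong\mathbb R^{3n}$ as topological vector spaces. (2) $M$ is connected (and non-empty). (3) For every $p\in M$, the stabiliser of $p$ in $T^n$ is a subtorus (a closed connected subgroup) of $T^n$, and its Lie algebra in $\mathbb R^n=\operatorname{Lie}(T^n)$ is the linear span of the $u_k$ with $\phi(p)\in H_k$. -/

import Mathlib

open scoped Quaternion

noncomputable section

namespace Hypertoric

/-! ### Imaginary quaternions and the quadratic map `x ↦ ½ x̄ i x` -/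

/-- The imaginary quaternions `Im ℍ`. -/
def ImH : Submodule ℝ ℍ[ℝ] where
  carrier := {q | q.re = 0}
  add_mem' := by
    intro a b ha hb
    simp only [Set.mem_ofPred_eq] at ha hb ⊢
    simp [ha, hb]
  zero_mem' := by simp
  smul_mem' := by
    intro c a ha
    simp only [Set.mem_ofPred_eq] at ha ⊢
    simp [ha]

/-- The quaternion `i`. -/
def qi : ℍ[ℝ] := ((Complex.I : ℂ) : ℍ[ℝ])

/-- The map `ℍ → Im ℍ`, `x ↦ ½ x̄ i x`. -/
def hopf (x : ℍ[ℝ]) : ImH :=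
  ⟨(1 / 2 : ℝ) • (star x * qi * x), by
    change ((1 / 2 : ℝ) • (star x * qi * x)).re = 0
    simp [qi]
    ring⟩

theorem norm_qi : ‖qi‖ = 1 := by
  have h : ‖qi‖ * ‖qi‖ = 1 := by
    rw [← Quaternion.normSq_eq_norm_mul_self, Quaternion.normSq_def']
    simp [qi]
  nlinarith [norm_nonneg qi]

theorem norm_hopf (x : ℍ[ℝ]) : ‖hopf x‖ = 1 / 2 * ‖x‖ ^ 2 := by
  change ‖(1 / 2 : ℝ) • (star x * qi * x)‖ = _
  rw [norm_smul, norm_mul, norm_mul, norm_qi, Quaternion.norm_star]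
  norm_num
  ring

/-- A unit complex number as a quaternion. -/
def circleToH (g : Circle) : ℍ[ℝ] := ((g : ℂ) : ℍ[ℝ])

theorem circleToH_one : circleToH 1 = 1 := by simp [circleToH]

theorem circleToH_mul (g h : Circle) : circleToH (g * h) = circleToH g * circleToH h := by
  simp [circleToH, Quaternion.coeComplex_mul]

theorem norm_coeComplex (z : ℂ) : ‖(z : ℍ[ℝ])‖ = ‖z‖ := by
  have h1 : ‖(z : ℍ[ℝ])‖ * ‖(z : ℍ[ℝ])‖ = ‖z‖ * ‖z‖ := by
    rw [← Quaternion.normSq_eq_norm_mul_self, Quaternion.normSq_def', Complex.norm_mul_self_eq_normSq,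
      Complex.normSq_apply]
    simp
    ring
  exact (mul_self_inj (norm_nonneg _) (norm_nonneg _)).1 h1

theorem norm_circleToH (g : Circle) : ‖circleToH g‖ = 1 := by
  rw [circleToH, norm_coeComplex, Circle.norm_coe]

theorem norm_one_sub_circleToH (g : Circle) : ‖circleToH g - 1‖ = ‖1 - (g : ℂ)‖ := by
  have : circleToH g - 1 = (((g : ℂ) - 1 : ℂ) : ℍ[ℝ]) := by
    ext <;> simp [circleToH]
  rw [this, norm_coeComplex, norm_sub_rev]

theorem hopf_smul (g : Circle) (x : ℍ[ℝ]) : hopf (circleToH g * x) = hopf x := by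
  apply Subtype.ext
  have hg : (g : ℂ).re * (g : ℂ).re + (g : ℂ).im * (g : ℂ).im = 1 := by
    rw [← Complex.normSq_apply]; simp
  have key : star (circleToH g) * qi * circleToH g = qi := by
    ext <;> simp [circleToH, qi] <;> linarith [hg]
  change (1 / 2 : ℝ) • (star (circleToH g * x) * qi * (circleToH g * x))
    = (1 / 2 : ℝ) • (star x * qi * x)
  rw [star_mul]
  congr 1
  calc star x * star (circleToH g) * qi * (circleToH g * x)
      = star x * (star (circleToH g) * qi * circleToH g) * x := by noncomm_ring
    _ = _ := by rw [key]

/-! ### Estimates on the circle -/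

theorem norm_one_sub_exp_sq (t : ℝ) :
    ‖1 - (Circle.exp t : ℂ)‖ ^ 2 = 2 - 2 * Real.cos t := by
  rw [← Complex.normSq_eq_norm_sq, Circle.coe_exp, Complex.normSq_apply]
  simp [Complex.exp_ofReal_mul_I_re, Complex.exp_ofReal_mul_I_im]
  nlinarith [Real.sin_sq_add_cos_sq t]

theorem norm_one_sub_exp_sq_le (t : ℝ) : ‖1 - (Circle.exp t : ℂ)‖ ^ 2 ≤ t ^ 2 := by
  rw [norm_one_sub_exp_sq]
  nlinarith [Real.one_sub_sq_div_two_le_cos (x := t)]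

theorem arg_sq_le (g : Circle) :
    (Complex.arg g) ^ 2 ≤ Real.pi ^ 2 / 4 * ‖1 - (g : ℂ)‖ ^ 2 := by
  have h := norm_one_sub_exp_sq (Complex.arg g)
  rw [Circle.exp_arg] at h
  have h3 : Real.cos (Complex.arg g) ≤ 1 - 2 / Real.pi ^ 2 * (Complex.arg g) ^ 2 := by
    exact Real.cos_le_one_sub_mul_cos_sq (Complex.abs_arg_le_pi _)
  rw [h]
  have hp := Real.pi_pos
  have : 2 / Real.pi ^ 2 * (Complex.arg g) ^ 2 * (Real.pi ^ 2 / 2) = (Complex.arg g) ^ 2 := by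
    field_simp
  nlinarith [mul_le_mul_of_nonneg_right h3 (by positivity : (0:ℝ) ≤ Real.pi ^ 2 / 2)]

/-! ### The torus `Tⁿ` -/

/-- The torus `Tⁿ = (S¹)ⁿ`. -/
abbrev Torus (n : ℕ) : Type := Fin n → Circle

/-- The exponential map `ℝⁿ → Tⁿ` (with kernel `(2πℤ)ⁿ`). -/
def torusExp {n : ℕ} (v : Fin n → ℝ) : Torus n := fun i => Circle.exp (v i)

theorem torusExp_add {n : ℕ} (v w : Fin n → ℝ) :
    torusExp (v + w) = torusExp v * torusExp w := by
  funext i; simp [torusExp, Circle.exp_add]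

/-- A subtorus of `Tⁿ`: a closed connected subgroup. -/
def IsSubtorus {n : ℕ} (H : Subgroup (Torus n)) : Prop :=
  IsClosed (H : Set (Torus n)) ∧ IsConnected (H : Set (Torus n))

/-- The Lie algebra of a subgroup of `Tⁿ`, as a subset of `Lie Tⁿ = ℝⁿ`: the generators of the
one-parameter subgroups that it contains. -/
def lieAlgebra {n : ℕ} (H : Subgroup (Torus n)) : Set (Fin n → ℝ) :=
  {v | ∀ s : ℝ, torusExp (s • v) ∈ H}

/-! ### The data -/

/-- The level `λ_k = -½ Λ̄_k i Λ_k ∈ Im ℍ`. -/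
def level {L : Type*} (Λ : L → ℍ[ℝ]) (k : L) : ImH := -hopf (Λ k)

/-- An integer vector seen in `ℝⁿ`. -/
def toReal {n : ℕ} (v : Fin n → ℤ) : Fin n → ℝ := fun i => (v i : ℝ)

/-- The vectors `Λ_k ∈ ℍ` and `u_k ∈ ℤⁿ`: the `u_k` are nonzero, primitive and span `ℝⁿ`,
and the `λ_k` satisfy the growth condition. -/
structure Data (n : ℕ) (L : Type*) where
  Λ : L → ℍ[ℝ]
  u : L → Fin n → ℤ
  u_ne_zero : ∀ k, u k ≠ 0
  u_primitive : ∀ k, ∀ m : ℤ, 1 < m → ¬ ∃ w : Fin n → ℤ, u k = m • w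
  u_span : Submodule.span ℝ (Set.range fun k => toReal (u k)) = ⊤
  growth : Summable fun k => (1 + ‖level Λ k‖)⁻¹

variable {n : ℕ} {L : Type*}

namespace Data

/-- `λ_k`. -/
def lam (D : Data n L) (k : L) : ImH := level D.Λ k

/-- `u_k` as a vector of `ℝⁿ = Lie Tⁿ`. -/
def uR (D : Data n L) (k : L) : Fin n → ℝ := toReal (D.u k)

theorem norm_Λ_sq (D : Data n L) (k : L) : ‖D.Λ k‖ ^ 2 = 2 * ‖D.lam k‖ := by
  have : ‖D.lam k‖ = 1 / 2 * ‖D.Λ k‖ ^ 2 := by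
    rw [lam, level, norm_neg, norm_hopf]
  linarith

/-- `Im ℍ ⊗ (ℝⁿ)^*`, realised as the space of linear maps `ℝⁿ → Im ℍ`. -/
abbrev Target (n : ℕ) : Type := (Fin n → ℝ) →L[ℝ] ImH

/-- The flat `H_k`. -/
def flat (D : Data n L) (k : L) : Set (Target n) := {a | a (D.uR k) = D.lam k}

/-- Whenever `n` distinct flats have a common point, the corresponding vectors `u_k` form a
`ℤ`-basis of `ℤⁿ`. -/
def FlatsUnimodular (D : Data n L) : Prop :=
  ∀ κ : Fin n → L, Function.Injective (fun i => D.flat (κ i)) →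
    (⋂ i, D.flat (κ i)).Nonempty →
      LinearIndependent ℤ (fun i => D.u (κ i)) ∧
        Submodule.span ℤ (Set.range fun i => D.u (κ i)) = ⊤

/-! ### The Hilbert manifold `M_Λ = Λ + L²(ℍ)` -/

/-- `M_Λ`. -/
def HilbertManifold (D : Data n L) : Type _ :=
  {x : L → ℍ[ℝ] // Memℓp (fun k => x k - D.Λ k) 2}

/-- The bijection `x ↦ x - Λ` of `M_Λ` with `L²(ℍ)`. -/
def toL2 (D : Data n L) (x : D.HilbertManifold) : lp (fun _ : L => ℍ[ℝ]) 2 :=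
  ⟨fun k => x.1 k - D.Λ k, x.2⟩

/-- The topology of the `L²`-metric. -/
instance (D : Data n L) : TopologicalSpace D.HilbertManifold :=
  TopologicalSpace.induced D.toL2 inferInstance

theorem memlp_two_iff {E : Type*} [NormedAddCommGroup E] {f : L → E} :
    Memℓp f 2 ↔ Summable fun k => ‖f k‖ ^ 2 := by
  rw [memℓp_gen_iff (by norm_num)]
  norm_num

theorem summable_sub (D : Data n L) (x : D.HilbertManifold) :
    Summable fun k => ‖x.1 k - D.Λ k‖ ^ 2 := memlp_two_iff.1 x.2

/-! ### The Lie algebra `𝔱_λ` -/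

/-- The vectors `t ∈ ℝ^L` with `∑ (1 + |λ_k|) t_k² < ∞`. -/
def lieSubmodule (D : Data n L) : Submodule ℝ (L → ℝ) where
  carrier := {t | Summable fun k => (1 + ‖D.lam k‖) * (t k) ^ 2}
  zero_mem' := by simp [summable_zero]
  add_mem' := by
    intro s t hs ht
    refine Summable.of_nonneg_of_le (fun k => by positivity) (fun k => ?_)
      ((hs.mul_left 2).add (ht.mul_left 2))
    have : (s k + t k) ^ 2 ≤ 2 * (s k) ^ 2 + 2 * (t k) ^ 2 := by nlinarith [sq_nonneg (s k - t k)]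
    have h0 : 0 ≤ 1 + ‖D.lam k‖ := by positivity
    simp only [Pi.add_apply]
    nlinarith [mul_le_mul_of_nonneg_left this h0]
  smul_mem' := by
    intro c t ht
    refine (ht.mul_left (c ^ 2)).congr (fun k => ?_)
    simp only [Pi.smul_apply, smul_eq_mul]
    ring

/-- `𝔱_λ`, with the Hilbert norm `(∑ (1 + |λ_k|) t_k²)^(1/2)`. -/
def LieT (D : Data n L) : Type _ := D.lieSubmodule

instance (D : Data n L) : AddCommGroup D.LieT := inferInstanceAs (AddCommGroup D.lieSubmodule)

instance (D : Data n L) : Module ℝ D.LieT := inferInstanceAs (Module ℝ D.lieSubmodule)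

/-- The inclusion of `𝔱_λ` in `ℝ^L`. -/
def coord (D : Data n L) : D.LieT →ₗ[ℝ] (L → ℝ) := D.lieSubmodule.subtype

theorem summable_coord (D : Data n L) (t : D.LieT) :
    Summable fun k => (1 + ‖D.lam k‖) * (D.coord t k) ^ 2 := t.2

theorem coord_injective (D : Data n L) : Function.Injective D.coord := Subtype.val_injective

/-- The element of `𝔱_λ` with given coordinates. -/
def ofCoord (D : Data n L) (t : L → ℝ)
    (ht : Summable fun k => (1 + ‖D.lam k‖) * (t k) ^ 2) : D.LieT := ⟨t, ht⟩

theorem coord_ofCoord (D : Data n L) (t : L → ℝ)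
    (ht : Summable fun k => (1 + ‖D.lam k‖) * (t k) ^ 2) : D.coord (D.ofCoord t ht) = t := rfl

/-- The linear isometry `t ↦ ((1 + |λ_k|)^(1/2) t_k)` into `ℓ²`. -/
def lieToL2 (D : Data n L) : D.LieT →ₗ[ℝ] lp (fun _ : L => ℝ) 2 where
  toFun t := ⟨fun k => Real.sqrt (1 + ‖D.lam k‖) * D.coord t k, by
    refine memlp_two_iff.2 (Summable.congr (D.summable_coord t) (fun k => ?_))
    rw [norm_mul, mul_pow, Real.norm_eq_abs, Real.norm_eq_abs, sq_abs, sq_abs,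
      Real.sq_sqrt (by positivity)]⟩
  map_add' s t := by
    apply Subtype.ext; funext k
    change Real.sqrt (1 + ‖D.lam k‖) * D.coord (s + t) k = _
    rw [map_add]; exact mul_add _ _ _
  map_smul' c t := by
    apply Subtype.ext; funext k
    change Real.sqrt (1 + ‖D.lam k‖) * D.coord (c • t) k = _
    rw [map_smul]; exact mul_left_comm _ _ _

theorem lieToL2_injective (D : Data n L) : Function.Injective D.lieToL2 := by
  intro s t h
  apply D.coord_injective
  funext k
  have hk : Real.sqrt (1 + ‖D.lam k‖) * D.coord s k = Real.sqrt (1 + ‖D.lam k‖) * D.coord t k :=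
    congrFun (congrArg Subtype.val h) k
  exact mul_left_cancel₀ (Real.sqrt_pos.2 (by positivity)).ne' hk

instance (D : Data n L) : NormedAddCommGroup D.LieT :=
  NormedAddCommGroup.induced _ _ D.lieToL2 D.lieToL2_injective

instance (D : Data n L) : NormedSpace ℝ D.LieT :=
  NormedSpace.induced ℝ _ _ D.lieToL2

open Classical in
/-- The vector `e_k ∈ 𝔱_λ`. -/
def e (D : Data n L) (k : L) : D.LieT :=
  D.ofCoord (fun j => if j = k then 1 else 0) (by
    refine summable_of_ne_finset_zero (s := {k}) (fun j hj => ?_)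
    have : j ≠ k := by simpa using hj
    simp [this])

/-- A continuous linear map `β : 𝔱_λ → ℝⁿ` with `β(e_k) = u_k`. -/
structure Beta (D : Data n L) where
  toCLM : D.LieT →L[ℝ] (Fin n → ℝ)
  map_e : ∀ k, toCLM (D.e k) = D.uR k

/-! ### The Hilbert group `T_λ` and its action -/

/-- `T_λ`. -/
def group (D : Data n L) : Subgroup (L → Circle) where
  carrier := {g | Summable fun k => (1 + ‖D.lam k‖) * ‖1 - (g k : ℂ)‖ ^ 2}
  one_mem' := by simp [summable_zero]
  mul_mem' := by
    intro g h hg hh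
    refine Summable.of_nonneg_of_le (fun k => by positivity) (fun k => ?_)
      ((hg.mul_left 2).add (hh.mul_left 2))
    have h1 : ‖1 - ((g k * h k : Circle) : ℂ)‖ ≤ ‖1 - (g k : ℂ)‖ + ‖1 - (h k : ℂ)‖ := by
      have : 1 - ((g k * h k : Circle) : ℂ) = (1 - (g k : ℂ)) + (g k : ℂ) * (1 - (h k : ℂ)) := by
        push_cast; ring
      rw [this]
      refine (norm_add_le _ _).trans ?_
      rw [norm_mul, Circle.norm_coe, one_mul]
    have h2 : ‖1 - ((g k * h k : Circle) : ℂ)‖ ^ 2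
        ≤ 2 * ‖1 - (g k : ℂ)‖ ^ 2 + 2 * ‖1 - (h k : ℂ)‖ ^ 2 := by
      nlinarith [norm_nonneg (1 - ((g k * h k : Circle) : ℂ)),
        sq_nonneg (‖1 - (g k : ℂ)‖ - ‖1 - (h k : ℂ)‖)]
    have h0 : 0 ≤ 1 + ‖D.lam k‖ := by positivity
    simp only [Pi.mul_apply]
    nlinarith [mul_le_mul_of_nonneg_left h2 h0]
  inv_mem' := by
    intro g hg
    refine Summable.congr hg (fun k => ?_)
    have : 1 - ((g k)⁻¹ : Circle) = -((g k : ℂ))⁻¹ * (1 - (g k : ℂ)) := by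
      rw [Circle.coe_inv]
      field_simp [Circle.coe_ne_zero]
      ring
    simp only [Pi.inv_apply]
    rw [this, norm_mul, norm_neg, norm_inv, Circle.norm_coe, inv_one, one_mul]

/-- The action `(gx)_k = g_k x_k` of `T_λ` on `M_Λ`. -/
instance (D : Data n L) : MulAction D.group D.HilbertManifold where
  smul g x := ⟨fun k => circleToH (g.1 k) * x.1 k, by
    rw [memlp_two_iff]
    have hg : Summable fun k => (1 + ‖D.lam k‖) * ‖1 - (g.1 k : ℂ)‖ ^ 2 := g.2
    refine Summable.of_nonneg_of_le (fun k => by positivity) (fun k => ?_)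
      (((D.summable_sub x).mul_left 2).add (hg.mul_left 4))
    have h1 : circleToH (g.1 k) * x.1 k - D.Λ k
        = circleToH (g.1 k) * (x.1 k - D.Λ k) + (circleToH (g.1 k) - 1) * D.Λ k := by
      noncomm_ring
    have h2 : ‖circleToH (g.1 k) * x.1 k - D.Λ k‖
        ≤ ‖x.1 k - D.Λ k‖ + ‖1 - (g.1 k : ℂ)‖ * ‖D.Λ k‖ := by
      rw [h1]
      refine (norm_add_le _ _).trans ?_
      rw [norm_mul, norm_mul, norm_circleToH, norm_one_sub_circleToH, one_mul]
    have h3 : ‖circleToH (g.1 k) * x.1 k - D.Λ k‖ ^ 2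
        ≤ 2 * ‖x.1 k - D.Λ k‖ ^ 2 + 2 * (‖1 - (g.1 k : ℂ)‖ * ‖D.Λ k‖) ^ 2 := by
      nlinarith [norm_nonneg (circleToH (g.1 k) * x.1 k - D.Λ k),
        sq_nonneg (‖x.1 k - D.Λ k‖ - ‖1 - (g.1 k : ℂ)‖ * ‖D.Λ k‖)]
    rw [mul_pow, D.norm_Λ_sq k] at h3
    nlinarith [sq_nonneg ‖1 - (g.1 k : ℂ)‖]⟩
  one_smul x := by
    apply Subtype.ext; funext k
    change circleToH 1 * x.1 k = x.1 k
    rw [circleToH_one, one_mul]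
  mul_smul g h x := by
    apply Subtype.ext; funext k
    change circleToH (g.1 k * h.1 k) * x.1 k = circleToH (g.1 k) * (circleToH (h.1 k) * x.1 k)
    rw [circleToH_mul, mul_assoc]

/-! ### The hyperkähler moment map `μ_Λ` -/

/-- The coefficient `λ_k + ½ x̄_k i x_k` of `e_k^*` in `μ_Λ(x)`. -/
def momentCoeff (D : Data n L) (x : D.HilbertManifold) (k : L) : ImH :=
  D.lam k + hopf (x.1 k)

theorem norm_momentCoeff_le (D : Data n L) (x : D.HilbertManifold) (k : L) :
    ‖D.momentCoeff x k‖
      ≤ ‖D.Λ k‖ * ‖x.1 k - D.Λ k‖ + 1 / 2 * ‖x.1 k - D.Λ k‖ ^ 2 := by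
  set v := x.1 k - D.Λ k with hv
  have hx : x.1 k = D.Λ k + v := by rw [hv]; abel
  have h1 : ((D.momentCoeff x k : ImH) : ℍ[ℝ])
      = (1 / 2 : ℝ) • (star (D.Λ k) * qi * v + star v * qi * D.Λ k + star v * qi * v) := by
    change -((1 / 2 : ℝ) • (star (D.Λ k) * qi * D.Λ k))
      + (1 / 2 : ℝ) • (star (x.1 k) * qi * x.1 k) = _
    rw [hx, ← smul_neg, ← smul_add, star_add]
    congr 1
    noncomm_ring
  change ‖((D.momentCoeff x k : ImH) : ℍ[ℝ])‖ ≤ _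
  rw [h1, norm_smul]
  have h2 := norm_add₃_le (a := star (D.Λ k) * qi * v) (b := star v * qi * D.Λ k)
    (c := star v * qi * v)
  simp only [norm_mul, Quaternion.norm_star, norm_qi] at h2
  norm_num
  nlinarith

theorem summable_moment (D : Data n L) (x : D.HilbertManifold) (t : D.LieT) :
    Summable fun k => D.coord t k • D.momentCoeff x k := by
  have ht := D.summable_coord t
  have hx := D.summable_sub x
  set S := ∑' k, (1 + ‖D.lam k‖) * (D.coord t k) ^ 2 with hS
  refine Summable.of_norm_bounded
    (g := fun k => (1 + ‖D.lam k‖) * (D.coord t k) ^ 2 + (1 + S) * ‖x.1 k - D.Λ k‖ ^ 2)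
    (ht.add (hx.mul_left _)) (fun k => ?_)
  have h1 : (1 + ‖D.lam k‖) * (D.coord t k) ^ 2 ≤ S :=
    ht.le_tsum k (fun j _ => by positivity)
  have h2 : (D.coord t k) ^ 2 ≤ S := by nlinarith [norm_nonneg (D.lam k), sq_nonneg (D.coord t k)]
  have h3 : |D.coord t k| ≤ 1 + S := by nlinarith [sq_abs (D.coord t k), sq_nonneg (|D.coord t k| - 1)]
  have h4 : |D.coord t k| * (‖D.Λ k‖ * ‖x.1 k - D.Λ k‖)
      ≤ 1 / 2 * ((2 * ‖D.lam k‖) * (D.coord t k) ^ 2) + 1 / 2 * ‖x.1 k - D.Λ k‖ ^ 2 := by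
    rw [← D.norm_Λ_sq k, ← sq_abs (D.coord t k)]
    nlinarith [sq_nonneg (‖D.Λ k‖ * |D.coord t k| - ‖x.1 k - D.Λ k‖)]
  rw [norm_smul, Real.norm_eq_abs]
  have h5 := mul_le_mul_of_nonneg_left (D.norm_momentCoeff_le x k) (abs_nonneg (D.coord t k))
  have h6 := mul_le_mul_of_nonneg_right h3 (sq_nonneg ‖x.1 k - D.Λ k‖)
  have h7 : 0 ≤ S := le_trans (by positivity) h1
  nlinarith [sq_nonneg ‖x.1 k - D.Λ k‖, sq_nonneg (D.coord t k),
    mul_nonneg h7 (sq_nonneg ‖x.1 k - D.Λ k‖)]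

/-- The moment map `μ_Λ(x) = ∑ (λ_k + ½ x̄_k i x_k) e_k^*` as an `Im ℍ`-valued linear form
on `𝔱_λ`. -/
def moment (D : Data n L) (x : D.HilbertManifold) : D.LieT →ₗ[ℝ] ImH where
  toFun t := ∑' k, D.coord t k • D.momentCoeff x k
  map_add' s t := by
    simp only [map_add]
    rw [← (D.summable_moment x s).tsum_add (D.summable_moment x t)]
    exact tsum_congr fun k => add_smul _ _ _
  map_smul' c t := by
    simp only [map_smul]
    rw [RingHom.id_apply, ← (D.summable_moment x t).tsum_const_smul c]
    exact tsum_congr fun k => mul_smul _ _ _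

theorem moment_smul (D : Data n L) (g : D.group) (x : D.HilbertManifold) :
    D.moment (g • x) = D.moment x := by
  have h : ∀ k, D.momentCoeff (g • x) k = D.momentCoeff x k := fun k => by
    change D.lam k + hopf (circleToH (g.1 k) * x.1 k) = _
    rw [hopf_smul]; rfl
  ext1 t
  exact tsum_congr fun k => by rw [h k]

end Data

/-! ### The homomorphism `T_λ → Tⁿ` and its kernel `N_β` -/

namespace Data

/-- The exponential map `𝔱_λ → T_λ`, `t ↦ (exp(i t_k))`. -/
def lieExp (D : Data n L) (t : D.LieT) : D.group :=
  ⟨fun k => Circle.exp (D.coord t k), by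
    refine Summable.of_nonneg_of_le (fun k => by positivity) (fun k => ?_) (D.summable_coord t)
    exact mul_le_mul_of_nonneg_left (norm_one_sub_exp_sq_le _) (by positivity)⟩

/-- A preimage of `g ∈ T_λ` under the exponential map. -/
def lieLog (D : Data n L) (g : D.group) : D.LieT :=
  D.ofCoord (fun k => Complex.arg (g.1 k)) (by
    have hg : Summable fun k => (1 + ‖D.lam k‖) * ‖1 - (g.1 k : ℂ)‖ ^ 2 := g.2
    refine Summable.of_nonneg_of_le (fun k => by positivity) (fun k => ?_)
      (hg.mul_left (Real.pi ^ 2 / 4))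
    have := mul_le_mul_of_nonneg_left (arg_sq_le (g.1 k))
      (by positivity : 0 ≤ 1 + ‖D.lam k‖)
    linarith)

theorem lieExp_lieLog (D : Data n L) (g : D.group) : D.lieExp (D.lieLog g) = g := by
  apply Subtype.ext; funext k; exact Circle.exp_arg _

theorem lieExp_add (D : Data n L) (s t : D.LieT) :
    D.lieExp (s + t) = D.lieExp s * D.lieExp t := by
  apply Subtype.ext; funext k; exact Circle.exp_add _ _

namespace Beta

variable {D : Data n L}

theorem surjective (b : D.Beta) : Function.Surjective b.toCLM.toLinearMap := by
  rw [← LinearMap.range_eq_top, ← top_le_iff, ← D.u_span, Submodule.span_le]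
  rintro _ ⟨k, rfl⟩
  exact ⟨D.e k, b.map_e k⟩

theorem torusExp_of_lieExp_eq_one (b : D.Beta) (t : D.LieT) (ht : D.lieExp t = 1) :
    torusExp (b.toCLM t) = 1 := by
  classical
  have h1 : ∀ k, ∃ m : ℤ, D.coord t k = m * (2 * Real.pi) := fun k =>
    Circle.exp_eq_one.1 (congrFun (congrArg Subtype.val ht) k)
  choose m hm using h1
  have hs := D.summable_coord t
  have hfin : {k | m k ≠ 0}.Finite := by
    have h2 := hs.tendsto_cofinite_zero.eventually (gt_mem_nhds one_pos)
    refine Set.Finite.subset (Filter.eventually_cofinite.1 h2) (fun k hk => ?_)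
    simp only [Set.mem_ofPred_eq, not_lt] at hk ⊢
    have h3 : (1 : ℝ) ≤ (m k : ℝ) ^ 2 := by
      have : (1 : ℤ) ≤ (m k) ^ 2 := Int.add_one_le_iff.2 (sq_pos_of_ne_zero hk)
      exact_mod_cast this
    have h4 : (1 : ℝ) ≤ (D.coord t k) ^ 2 := by
      rw [hm k, mul_pow]
      nlinarith [Real.pi_gt_three]
    nlinarith [norm_nonneg (D.lam k)]
  have ht' : t = ∑ k ∈ hfin.toFinset, (D.coord t k) • D.e k := by
    apply D.coord_injective
    rw [map_sum]
    funext j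
    simp only [map_smul, e, coord_ofCoord, Finset.sum_apply, Pi.smul_apply, smul_eq_mul, mul_ite,
      mul_one, mul_zero, Finset.sum_ite_eq, Set.Finite.mem_toFinset, Set.mem_ofPred_eq]
    split_ifs with hj
    · rfl
    · rw [hm j, not_not.1 hj]; simp
  funext i
  rw [ht', map_sum]
  change Circle.exp ((∑ k ∈ hfin.toFinset, b.toCLM (D.coord t k • D.e k)) i) = 1
  rw [Circle.exp_eq_one]
  refine ⟨∑ k ∈ hfin.toFinset, m k * D.u k i, ?_⟩
  rw [Finset.sum_apply]
  push_cast
  rw [Finset.sum_mul]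
  refine Finset.sum_congr rfl (fun k _ => ?_)
  rw [map_smul, b.map_e, hm k]
  simp only [Pi.smul_apply, smul_eq_mul, uR, toReal]
  ring

theorem torusExp_congr (b : D.Beta) {s t : D.LieT} (h : D.lieExp s = D.lieExp t) :
    torusExp (b.toCLM s) = torusExp (b.toCLM t) := by
  have h1 : D.lieExp (s - t) = 1 := by
    have h2 := D.lieExp_add (s - t) t
    rw [sub_add_cancel, h] at h2
    exact (right_eq_mul.1 h2)
  have h3 := b.torusExp_of_lieExp_eq_one _ h1
  calc torusExp (b.toCLM s) = torusExp (b.toCLM (s - t) + b.toCLM t) := by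
        rw [← map_add, sub_add_cancel]
    _ = _ := by rw [torusExp_add, h3, one_mul]

/-- The homomorphism `exp ∘ β ∘ exp⁻¹ : T_λ → Tⁿ`. -/
def hom (b : D.Beta) : D.group →* Torus n :=
  MonoidHom.mk' (fun g => torusExp (b.toCLM (D.lieLog g))) (fun g h => by
    rw [← torusExp_add, ← map_add]
    apply b.torusExp_congr
    rw [D.lieExp_add, D.lieExp_lieLog, D.lieExp_lieLog, D.lieExp_lieLog])

theorem hom_lieExp (b : D.Beta) (t : D.LieT) : b.hom (D.lieExp t) = torusExp (b.toCLM t) :=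
  b.torusExp_congr (D.lieExp_lieLog _)

theorem hom_surjective (b : D.Beta) : Function.Surjective b.hom := by
  intro τ
  obtain ⟨t, ht⟩ := b.surjective (fun i => Complex.arg (τ i))
  refine ⟨D.lieExp t, ?_⟩
  rw [hom_lieExp]
  funext i
  have : b.toCLM t i = Complex.arg (τ i) := congrFun ht i
  rw [torusExp, this, Circle.exp_arg]

/-- `N_β`. -/
def N (b : D.Beta) : Subgroup D.group := b.hom.ker

/-- The isomorphism `T_λ / N_β ≅ Tⁿ`. -/
def quotientEquiv (b : D.Beta) : D.group ⧸ b.N ≃* Torus n :=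
  QuotientGroup.quotientKerEquivOfSurjective b.hom b.hom_surjective

/-! ### The hyperkähler quotient `M(β, λ)` -/

/-- The zero set of `μ_β = ι^* μ_Λ`, where `ι` is the inclusion of `𝔫_β = ker β` in `𝔱_λ`. -/
def ZeroSet (b : D.Beta) : Type _ :=
  {x : D.HilbertManifold // ∀ t ∈ b.toCLM.toLinearMap.ker, D.moment x t = 0}

instance (b : D.Beta) : TopologicalSpace b.ZeroSet :=
  inferInstanceAs (TopologicalSpace {x : D.HilbertManifold //
    ∀ t ∈ b.toCLM.toLinearMap.ker, D.moment x t = 0})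

instance (b : D.Beta) : MulAction D.group b.ZeroSet where
  smul g x := ⟨g • x.1, fun t ht => by rw [moment_smul]; exact x.2 t ht⟩
  one_smul x := Subtype.ext (one_smul _ x.1)
  mul_smul g h x := Subtype.ext (mul_smul g h x.1)

/-- `M(β, λ) = μ_β⁻¹(0) / N_β`. -/
def M (b : D.Beta) : Type _ := MulAction.orbitRel.Quotient b.N b.ZeroSet

/-- The quotient topology. -/
instance (b : D.Beta) : TopologicalSpace b.M :=
  inferInstanceAs (TopologicalSpace (Quotient (MulAction.orbitRel b.N b.ZeroSet)))

/-- The class in `M` of a point of `μ_β⁻¹(0)`. -/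
def proj (b : D.Beta) (x : b.ZeroSet) : b.M := Quotient.mk (MulAction.orbitRel b.N b.ZeroSet) x

theorem proj_smul (b : D.Beta) (h : D.group) (hh : h ∈ b.N) (x : b.ZeroSet) :
    b.proj (h • x) = b.proj x :=
  Quotient.sound (s := MulAction.orbitRel b.N b.ZeroSet) ⟨⟨h, hh⟩, rfl⟩

/-- The action of `T_λ` on `M`. -/
instance groupAction (b : D.Beta) : MulAction D.group b.M where
  smul g := Quotient.map (sa := MulAction.orbitRel b.N b.ZeroSet)
    (sb := MulAction.orbitRel b.N b.ZeroSet) (fun x => g • x) (by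
      rintro x y ⟨h, rfl⟩
      exact ⟨h, smul_comm (h : D.group) g y⟩)
  one_smul p := by
    induction p using Quotient.inductionOn with
    | _ x => exact congrArg b.proj (one_smul D.group x)
  mul_smul g h p := by
    induction p using Quotient.inductionOn with
    | _ x => exact congrArg b.proj (mul_smul g h x)

/-- The induced action of `T_λ / N_β` on `M`. -/
def quotientActionHom (b : D.Beta) : D.group ⧸ b.N →* Equiv.Perm b.M :=
  QuotientGroup.lift b.N (MulAction.toPermHom D.group b.M) (by
    intro h hh
    ext p
    induction p using Quotient.inductionOn with
    | _ x => exact b.proj_smul h hh x)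

/-- The residual action of `Tⁿ = T_λ / N_β` on `M`. -/
instance torusAction (b : D.Beta) : MulAction (Torus n) b.M where
  smul τ p := b.quotientActionHom (b.quotientEquiv.symm τ) p
  one_smul p := by
    change b.quotientActionHom (b.quotientEquiv.symm 1) p = p
    simp
  mul_smul σ τ p := by
    change b.quotientActionHom (b.quotientEquiv.symm (σ * τ)) p =
      b.quotientActionHom (b.quotientEquiv.symm σ) (b.quotientActionHom (b.quotientEquiv.symm τ) p)
    simp

/-- The action of the class of `g ∈ T_λ` on `M` is induced by the action of `g`. -/
theorem hom_smul_proj (b : D.Beta) (g : D.group) (x : b.ZeroSet) :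
    b.hom g • b.proj x = b.proj (g • x) := by
  have : b.quotientEquiv.symm (b.hom g) = (g : D.group ⧸ b.N) := by
    rw [MulEquiv.symm_apply_eq]; rfl
  change b.quotientActionHom (b.quotientEquiv.symm (b.hom g)) (b.proj x) = _
  rw [this]
  rfl

/-- `M / Tⁿ`, with the quotient topology. -/
abbrev OrbitSpace (b : D.Beta) : Type _ := Quotient (MulAction.orbitRel (Torus n) b.M)

/-! ### The hyperkähler moment map `φ` of the residual action -/

/-- On `μ_β⁻¹(0)` the form `μ_Λ(x)` vanishes on `ker β`, hence is a form on
`𝔱_λ / ker β = ℝⁿ = Lie Tⁿ`. -/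
def phiZero (b : D.Beta) (x : b.ZeroSet) : Target n :=
  LinearMap.toContinuousLinearMap
    ((b.toCLM.toLinearMap.ker.liftQ (D.moment x.1) x.2) ∘ₗ
      (b.toCLM.toLinearMap.quotKerEquivOfSurjective b.surjective).symm.toLinearMap)

/-- The hyperkähler moment map `φ : M → Im ℍ ⊗ (ℝⁿ)^*` induced by `μ_Λ`. -/
def phi (b : D.Beta) : b.M → Target n :=
  Quotient.lift (s := MulAction.orbitRel b.N b.ZeroSet) b.phiZero (by
    rintro x y ⟨h, rfl⟩
    ext1 v
    obtain ⟨t, rfl⟩ := b.surjective v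
    have key : ∀ z : b.ZeroSet, b.phiZero z (b.toCLM.toLinearMap t) = D.moment z.1 t := by
      intro z
      have : (b.toCLM.toLinearMap.quotKerEquivOfSurjective b.surjective).symm
          (b.toCLM.toLinearMap t) = Submodule.Quotient.mk t := by
        rw [LinearEquiv.symm_apply_eq]; rfl
      simp only [phiZero, LinearMap.coe_toContinuousLinearMap', LinearMap.comp_apply,
        LinearEquiv.coe_coe, this]
      rfl
    rw [key, key]
    exact LinearMap.congr_fun (D.moment_smul (h : D.group) y.1) t)

end Beta

end Data

end Hypertoric

end

/-!
The coefficient of `e_k^*` in `μ_Λ(x)` is `λ_k + ½ x̄_k i x_k`, so a point of `μ_β⁻¹(0)` with moment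
value `a` is a point `x` of `M_Λ` with `½ x̄_k i x_k = a(u_k) - λ_k` for all `k`. Everything is
reduced to the Hopf-type map `x ↦ ½ x̄ i x` from `ℍ` to `Im ℍ`, which is surjective with the circle
orbits as fibres. The squared distance between two circle orbits with values `X`, `Y` is at most
`2 |X - Y|` and at most `2 |X - Y|² / (|X| + |Y|)`; `exists_circle_norm_sub_sq_le` combines the two
bounds.

Continuity of `β` means that `∑ |u_k|² (1 + |λ_k|)⁻¹` converges (`summable_norm_uR_sq`). Together
with the estimate above, changing the moment value by `a` can be realised by moving `x` by an
`L²`-distance which tends to zero with `a` (`exists_hopf_eq_add_apply`). Starting from `Λ`, this shows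
that the map `μ_β⁻¹(0) → Im ℍ ⊗ (ℝⁿ)^*` is surjective; starting from a general point, that it is
open. Its fibres are the orbits of `T_λ` (`exists_smul_eq`), so the induced map on
`M / Tⁿ = μ_β⁻¹(0) / T_λ` is a homeomorphism. The orbits are continuous images of the vector space
`𝔱_λ`, and an open surjection onto a connected space with connected fibres has a connected domain;
hence `M` is connected.

The stabiliser in `T_λ` of `x` consists of the elements supported on the finite set of those `k`
with `x_k = 0`, that is `φ(p) ∈ H_k`. Its image in `Tⁿ` is `exp V`, where `V` is the span of the
corresponding `u_k`; it is also the image of a compact cube, hence closed. Since `ℤⁿ` is countable,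
`exp V` contains no one-parameter subgroups besides those with generator in `V`.

For the existence of `β`, unimodularity bounds the coordinates of all `u_k` with respect to a basis
consisting of some of them (`FlatsUnimodular.abs_repr_le`), and for bounded `u_k` the series
`∑ t_k u_k` is controlled by the Cauchy–Schwarz inequality and the growth condition.
-/

open scoped Quaternion

namespace Hypertoric

variable {n : ℕ} {L : Type*}

/-! ### The quadratic map `x ↦ ½ x̄ i x` and its circle orbits -/

theorem hopf_coords (x : ℍ[ℝ]) :
    (hopf x : ℍ[ℝ]).re = 0 ∧
    (hopf x : ℍ[ℝ]).imI = 1 / 2 * (x.re ^ 2 + x.imI ^ 2 - x.imJ ^ 2 - x.imK ^ 2) ∧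
    (hopf x : ℍ[ℝ]).imJ = x.imI * x.imJ - x.re * x.imK ∧
    (hopf x : ℍ[ℝ]).imK = x.imI * x.imK + x.re * x.imJ := by
  refine ⟨(hopf x).2, ?_, ?_, ?_⟩ <;>
  · simp [hopf, qi]
    ring

theorem sq_norm_eq_coords (x : ℍ[ℝ]) :
    ‖x‖ ^ 2 = x.re ^ 2 + x.imI ^ 2 + x.imJ ^ 2 + x.imK ^ 2 := by
  rw [sq, ← Quaternion.normSq_eq_norm_mul_self, Quaternion.normSq_def']

theorem hopf_surjective : Function.Surjective hopf := by
  intro ξ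
  set p := (ξ : ℍ[ℝ]).imI with hp
  set q := (ξ : ℍ[ℝ]).imJ with hq
  set r := (ξ : ℍ[ℝ]).imK with hr
  have h0 : (ξ : ℍ[ℝ]).re = 0 := ξ.2
  set ρ := √(p ^ 2 + q ^ 2 + r ^ 2) with hρ
  have hρ2 : ρ ^ 2 = p ^ 2 + q ^ 2 + r ^ 2 := Real.sq_sqrt (by positivity)
  have hρ0 : 0 ≤ ρ := Real.sqrt_nonneg _
  have hle : |p| ≤ ρ := abs_le_of_sq_le_sq (by nlinarith [sq_nonneg q, sq_nonneg r]) hρ0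
  have hpos : 0 ≤ ρ + p := by linarith [neg_abs_le p]
  suffices h : ∃ x : ℍ[ℝ], 1 / 2 * (x.re ^ 2 + x.imI ^ 2 - x.imJ ^ 2 - x.imK ^ 2) = p ∧
      x.imI * x.imJ - x.re * x.imK = q ∧ x.imI * x.imK + x.re * x.imJ = r by
    obtain ⟨x, h1, h2, h3⟩ := h
    obtain ⟨k0, k1, k2, k3⟩ := hopf_coords x
    exact ⟨x, Subtype.ext (Quaternion.ext _ _ (k0.trans h0.symm) (k1.trans h1) (k2.trans h2)
      (k3.trans h3))⟩
  rcases hpos.eq_or_lt with h | h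
  · -- here `ξ` is a nonpositive multiple of `i`
    have hqr : q ^ 2 + r ^ 2 = 0 := by
      have : p = -ρ := by linarith
      rw [this] at hρ2
      linarith
    have hq0 : q = 0 := by nlinarith [sq_nonneg q, sq_nonneg r]
    have hr0 : r = 0 := by nlinarith [sq_nonneg q, sq_nonneg r]
    refine ⟨⟨0, 0, √(2 * ρ), 0⟩, ?_, ?_, ?_⟩
    · have := Real.sq_sqrt (by positivity : 0 ≤ 2 * ρ)
      simp only []
      rw [this]; linarith
    · simp [hq0]
    · simp [hr0]
  · set a := √(ρ + p) with ha
    have ha0 : 0 < a := Real.sqrt_pos.2 h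
    have ha2 : a ^ 2 = ρ + p := Real.sq_sqrt hpos
    refine ⟨⟨a, 0, r / a, -q / a⟩, ?_, ?_, ?_⟩
    · have : q ^ 2 + r ^ 2 = a ^ 2 * (ρ - p) := by rw [ha2]; linarith
      field_simp
      nlinarith
    · simp only []
      field_simp
      ring
    · simp only []
      field_simp
      ring

/-- The circle is large enough to rotate any complex number to its absolute value. -/
theorem exists_circle_mul_re_eq_norm (c : ℂ) : ∃ g : Circle, ((g : ℂ) * c).re = ‖c‖ := by
  refine ⟨Circle.exp (-Complex.arg c), ?_⟩
  conv_lhs => rw [← Complex.norm_mul_exp_arg_mul_I c]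
  rw [Circle.coe_exp, mul_left_comm, ← Complex.exp_add]
  simp

/-- If `c` is the Hermitian product of `y` and `x`, and `s = |X| + |Y|` for the values `X`, `Y` of
the quadratic map, then `|c|² = s² - |Y - X|²`, and the distance `d` from `x` to the circle orbit of
`y` has `d² = 2(s - |c|)`; hence both `d² ≤ 2|Y - X|` and `s d² ≤ 2|Y - X|²`. -/
theorem exists_circle_norm_sub_sq_le (x y : ℍ[ℝ]) : ∃ g : Circle,
    ‖circleToH g * y - x‖ ^ 2 * (1 + ‖hopf x‖)
      ≤ 2 * (‖hopf y - hopf x‖ + ‖hopf y - hopf x‖ ^ 2) := by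
  set c : ℂ := ⟨(y * star x).re, (y * star x).imI⟩ with hc
  obtain ⟨g, hg⟩ := exists_circle_mul_re_eq_norm c
  refine ⟨g, ?_⟩
  set s := ‖hopf x‖ + ‖hopf y‖ with hs
  set η := ‖hopf y - hopf x‖ with hη
  have hs0 : 0 ≤ s := by positivity
  have hη0 : 0 ≤ η := norm_nonneg _
  have hc0 : 0 ≤ ‖c‖ := norm_nonneg _
  have hs' : s = 1 / 2 * (‖x‖ ^ 2 + ‖y‖ ^ 2) := by rw [hs, norm_hopf, norm_hopf]; ring
  have hc2 : ‖c‖ ^ 2 = s ^ 2 - η ^ 2 := by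
    have h1 : η ^ 2 = ‖((hopf y - hopf x : ImH) : ℍ[ℝ])‖ ^ 2 := rfl
    obtain ⟨x0, x1, x2, x3⟩ := hopf_coords x
    obtain ⟨y0, y1, y2, y3⟩ := hopf_coords y
    rw [h1, sq_norm_eq_coords, hs', sq_norm_eq_coords x, sq_norm_eq_coords y,
      ← Complex.normSq_eq_norm_sq, Complex.normSq_apply]
    simp only [hc, Submodule.coe_sub, Quaternion.re_sub, Quaternion.imI_sub, Quaternion.imJ_sub,
      Quaternion.imK_sub, x0, x1, x2, x3, y0, y1, y2, y3]
    simp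
    ring
  have hd : ‖circleToH g * y - x‖ ^ 2 = 2 * (s - ‖c‖) := by
    have h1 : ‖circleToH g * y - x‖ ^ 2
        = ‖circleToH g * y‖ ^ 2 + ‖x‖ ^ 2 - 2 * ((g : ℂ) * c).re := by
      rw [sq_norm_eq_coords, sq_norm_eq_coords, sq_norm_eq_coords x]
      simp [circleToH, hc]
      ring
    rw [h1, norm_mul, norm_circleToH, hg, hs']
    ring
  rw [hd]
  have h1 : s - ‖c‖ ≤ η := by
    by_contra! h
    nlinarith
  have h2 : (s - ‖c‖) * s ≤ η ^ 2 := by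
    have h3 : 0 ≤ s - ‖c‖ := by nlinarith [sq_nonneg ‖circleToH g * y - x‖]
    nlinarith
  have h3 : (s - ‖c‖) * ‖hopf x‖ ≤ (s - ‖c‖) * s :=
    mul_le_mul_of_nonneg_left (by rw [hs]; linarith [norm_nonneg (hopf y)])
      (by nlinarith [sq_nonneg ‖circleToH g * y - x‖])
  nlinarith

/-- The quadratic map lifts any perturbation `η` of its value at `x` to a perturbation of `x`
which is small, all the more so if `x` is large. -/
theorem exists_hopf_eq_norm_sub_sq_le (x : ℍ[ℝ]) (η : ImH) : ∃ y : ℍ[ℝ],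
    hopf y = hopf x + η ∧ ‖y - x‖ ^ 2 * (1 + ‖hopf x‖) ≤ 2 * (‖η‖ + ‖η‖ ^ 2) := by
  obtain ⟨y, hy⟩ := hopf_surjective (hopf x + η)
  obtain ⟨g, hg⟩ := exists_circle_norm_sub_sq_le x y
  refine ⟨circleToH g * y, by rw [hopf_smul, hy], ?_⟩
  rwa [hy, add_sub_cancel_left] at hg

theorem exists_circle_mul_eq {x y : ℍ[ℝ]} (h : hopf y = hopf x) :
    ∃ g : Circle, circleToH g * x = y := by
  obtain ⟨g, hg⟩ := exists_circle_norm_sub_sq_le y x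
  refine ⟨g, ?_⟩
  rw [h, sub_self, norm_zero] at hg
  have h1 : ‖circleToH g * x - y‖ ^ 2 ≤ 0 := by
    nlinarith [norm_nonneg (hopf x), sq_nonneg ‖circleToH g * x - y‖]
  have h2 : ‖circleToH g * x - y‖ = 0 := by nlinarith [norm_nonneg (circleToH g * x - y)]
  exact sub_eq_zero.1 (norm_eq_zero.1 h2)

theorem hopf_eq_zero_iff {x : ℍ[ℝ]} : hopf x = 0 ↔ x = 0 := by
  rw [← norm_eq_zero, norm_hopf]
  simp

/-! ### Analysis on `M_Λ` and `𝔱_λ` -/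

theorem norm_sq_lp_two {E : Type*} [NormedAddCommGroup E] (f : lp (fun _ : L => E) 2) :
    HasSum (fun k => ‖f k‖ ^ 2) (‖f‖ ^ 2) := by
  have h := lp.hasSum_norm (p := 2) (by norm_num) f
  norm_num at h
  exact h

/-- The Cauchy–Schwarz inequality for series. -/
theorem exists_hasSum_mul_le {f g : L → ℝ} {A B : ℝ} (hf : ∀ k, 0 ≤ f k) (hg : ∀ k, 0 ≤ g k)
    (hA : 0 ≤ A) (hB : 0 ≤ B) (hfA : HasSum (fun k => f k ^ 2) (A ^ 2))
    (hgB : HasSum (fun k => g k ^ 2) (B ^ 2)) :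
    ∃ C, C ≤ A * B ∧ HasSum (fun k => f k * g k) C := by
  obtain ⟨C, -, h⟩ := Real.inner_le_Lp_mul_Lq_hasSum_of_nonneg (p := 2) (q := 2)
    Real.HolderConjugate.two_two hA hB hf hg (by exact_mod_cast hfA) (by exact_mod_cast hgB)
  exact ⟨C, h⟩

namespace Data

variable (D : Data n L)

theorem hasSum_norm_sub_sq (x y : D.HilbertManifold) :
    HasSum (fun k => ‖x.1 k - y.1 k‖ ^ 2) (‖D.toL2 x - D.toL2 y‖ ^ 2) := by
  refine (norm_sq_lp_two _).congr_fun fun k => ?_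
  have : (D.toL2 x - D.toL2 y) k = (x.1 k - D.Λ k) - (y.1 k - D.Λ k) := rfl
  rw [this, sub_sub_sub_cancel_right]

theorem hasSum_norm_lieT_sq (t : D.LieT) :
    HasSum (fun k => (1 + ‖D.lam k‖) * (D.coord t k) ^ 2) (‖t‖ ^ 2) := by
  refine (norm_sq_lp_two (D.lieToL2 t)).congr_fun fun k => ?_
  change _ = ‖Real.sqrt (1 + ‖D.lam k‖) * D.coord t k‖ ^ 2
  rw [norm_mul, mul_pow, Real.norm_eq_abs, Real.norm_eq_abs, sq_abs, sq_abs,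
    Real.sq_sqrt (by positivity)]

theorem coord_e [DecidableEq L] (k j : L) : D.coord (D.e k) j = if j = k then 1 else 0 := by
  rw [e, coord_ofCoord]
  congr

theorem hasSum_coord_smul_e (t : D.LieT) : HasSum (fun k => D.coord t k • D.e k) t := by
  classical
  have hind : Topology.IsInducing D.lieToL2 := ⟨rfl⟩
  rw [← hind.hasSum_iff]
  refine (lp.hasSum_single (by norm_num) (D.lieToL2 t)).congr_fun fun k => ?_
  apply Subtype.ext
  funext j
  change Real.sqrt (1 + ‖D.lam j‖) * D.coord (D.coord t k • D.e k) j
    = (lp.single (E := fun _ : L => ℝ) 2 k (Real.sqrt (1 + ‖D.lam k‖) * D.coord t k)) j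
  rw [map_smul, lp.coeFn_single, Pi.smul_apply, coord_e]
  by_cases h : j = k
  · subst h; simp
  · simp [h]

theorem moment_e (x : D.HilbertManifold) (k : L) : D.moment x (D.e k) = D.momentCoeff x k := by
  classical
  change ∑' j, D.coord (D.e k) j • D.momentCoeff x j = _
  rw [tsum_eq_single k]
  · simp [coord_e]
  · intro j hj
    simp [coord_e, hj]

/-- The level is controlled by any point of `M_Λ`. -/
theorem one_add_norm_lam_le (x : D.HilbertManifold) (k : L) :
    1 + ‖D.lam k‖ ≤ (2 + ‖D.toL2 x‖ ^ 2) * (1 + ‖hopf (x.1 k)‖) := by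
  have h1 : ‖x.1 k - D.Λ k‖ ≤ ‖D.toL2 x‖ := lp.norm_apply_le_norm (by norm_num) (D.toL2 x) k
  have h2 := D.norm_Λ_sq k
  have h3 := norm_hopf (x.1 k)
  have h4 : ‖D.Λ k‖ ≤ ‖x.1 k‖ + ‖x.1 k - D.Λ k‖ := by
    have := norm_sub_le (x.1 k) (x.1 k - D.Λ k)
    rwa [sub_sub_cancel] at this
  have h5 : ‖D.Λ k‖ ^ 2 ≤ 2 * ‖x.1 k‖ ^ 2 + 2 * ‖x.1 k - D.Λ k‖ ^ 2 :=
    (pow_le_pow_left₀ (norm_nonneg _) h4 2).trans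
      (by nlinarith [sq_nonneg (‖x.1 k‖ - ‖x.1 k - D.Λ k‖)])
  have h6 : ‖x.1 k - D.Λ k‖ ^ 2 ≤ ‖D.toL2 x‖ ^ 2 := pow_le_pow_left₀ (norm_nonneg _) h1 2
  nlinarith [norm_nonneg (hopf (x.1 k)), sq_nonneg ‖D.toL2 x‖,
    mul_nonneg (sq_nonneg ‖D.toL2 x‖) (norm_nonneg (hopf (x.1 k)))]

/-- Conversely, a point of `M_Λ` is controlled by the level. -/
theorem norm_sq_le (x : D.HilbertManifold) (k : L) :
    ‖x.1 k‖ ^ 2 ≤ (4 + 2 * ‖D.toL2 x‖ ^ 2) * (1 + ‖D.lam k‖) := by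
  have h1 : ‖x.1 k - D.Λ k‖ ≤ ‖D.toL2 x‖ := lp.norm_apply_le_norm (by norm_num) (D.toL2 x) k
  have h2 := D.norm_Λ_sq k
  have h4 : ‖x.1 k‖ ≤ ‖D.Λ k‖ + ‖x.1 k - D.Λ k‖ := by
    have := norm_add_le (D.Λ k) (x.1 k - D.Λ k)
    rwa [add_sub_cancel] at this
  have h5 : ‖x.1 k‖ ^ 2 ≤ 2 * ‖D.Λ k‖ ^ 2 + 2 * ‖x.1 k - D.Λ k‖ ^ 2 :=
    (pow_le_pow_left₀ (norm_nonneg _) h4 2).trans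
      (by nlinarith [sq_nonneg (‖D.Λ k‖ - ‖x.1 k - D.Λ k‖)])
  have h6 : ‖x.1 k - D.Λ k‖ ^ 2 ≤ ‖D.toL2 x‖ ^ 2 := pow_le_pow_left₀ (norm_nonneg _) h1 2
  nlinarith [norm_nonneg (D.lam k), sq_nonneg ‖D.toL2 x‖,
    mul_nonneg (sq_nonneg ‖D.toL2 x‖) (norm_nonneg (D.lam k))]

/-- A summable perturbation `η` of the values of the quadratic map lifts to `M_Λ`, with control of
the `L²`-distance. Applied to `Λ` this yields surjectivity of the moment map, and applied to a
general point it yields openness. -/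
theorem exists_hopf_eq_dist_sq_le (x : D.HilbertManifold) (η : L → ImH)
    (hη : Summable fun k => (‖η k‖ + ‖η k‖ ^ 2) * (1 + ‖D.lam k‖)⁻¹) :
    ∃ y : D.HilbertManifold, (∀ k, hopf (y.1 k) = hopf (x.1 k) + η k) ∧
      ‖D.toL2 y - D.toL2 x‖ ^ 2 ≤ 2 * (2 + ‖D.toL2 x‖ ^ 2) *
        ∑' k, (‖η k‖ + ‖η k‖ ^ 2) * (1 + ‖D.lam k‖)⁻¹ := by
  choose y hy hle using fun k => exists_hopf_eq_norm_sub_sq_le (x.1 k) (η k)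
  have hb : ∀ k, ‖y k - x.1 k‖ ^ 2 ≤ 2 * (2 + ‖D.toL2 x‖ ^ 2) *
      ((‖η k‖ + ‖η k‖ ^ 2) * (1 + ‖D.lam k‖)⁻¹) := fun k => by
    have h1 := D.one_add_norm_lam_le x k
    have h2 : 0 < 1 + ‖D.lam k‖ := by positivity
    rw [← mul_assoc, ← div_eq_mul_inv, le_div_iff₀ h2]
    calc ‖y k - x.1 k‖ ^ 2 * (1 + ‖D.lam k‖)
        ≤ ‖y k - x.1 k‖ ^ 2 * ((2 + ‖D.toL2 x‖ ^ 2) * (1 + ‖hopf (x.1 k)‖)) := by gcongr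
      _ = (2 + ‖D.toL2 x‖ ^ 2) * (‖y k - x.1 k‖ ^ 2 * (1 + ‖hopf (x.1 k)‖)) := by ring
      _ ≤ (2 + ‖D.toL2 x‖ ^ 2) * (2 * (‖η k‖ + ‖η k‖ ^ 2)) := by
        exact mul_le_mul_of_nonneg_left (hle k) (by positivity)
      _ = _ := by ring
  have hs : Summable fun k => ‖y k - x.1 k‖ ^ 2 :=
    Summable.of_nonneg_of_le (fun k => by positivity) hb (hη.mul_left _)
  have hmem : Memℓp (fun k => y k - D.Λ k) 2 := by
    rw [memlp_two_iff]
    refine Summable.of_nonneg_of_le (fun k => by positivity) (fun k => ?_)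
      ((hs.mul_left 2).add ((D.summable_sub x).mul_left 2))
    have h1 : ‖y k - D.Λ k‖ ≤ ‖y k - x.1 k‖ + ‖x.1 k - D.Λ k‖ := norm_sub_le_norm_sub_add_norm_sub ..
    exact (pow_le_pow_left₀ (norm_nonneg _) h1 2).trans
      (by nlinarith [sq_nonneg (‖y k - x.1 k‖ - ‖x.1 k - D.Λ k‖)])
  refine ⟨⟨y, hmem⟩, hy, ?_⟩
  rw [← (D.hasSum_norm_sub_sq ⟨y, hmem⟩ x).tsum_eq, ← tsum_mul_left]
  exact hs.tsum_le_tsum hb (hη.mul_left _)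

theorem norm_momentCoeff_sub_le (x y : D.HilbertManifold) (k : L) :
    ‖D.momentCoeff y k - D.momentCoeff x k‖
      ≤ ‖x.1 k‖ * ‖y.1 k - x.1 k‖ + 1 / 2 * ‖y.1 k - x.1 k‖ ^ 2 := by
  set v := y.1 k - x.1 k with hv
  have hy : y.1 k = x.1 k + v := by rw [hv]; abel
  have h1 : ((D.momentCoeff y k - D.momentCoeff x k : ImH) : ℍ[ℝ])
      = (1 / 2 : ℝ) • (star (x.1 k) * qi * v + star v * qi * x.1 k + star v * qi * v) := by
    have : D.momentCoeff y k - D.momentCoeff x k = hopf (y.1 k) - hopf (x.1 k) :=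
      add_sub_add_left_eq_sub _ _ _
    rw [this]
    change (1 / 2 : ℝ) • (star (y.1 k) * qi * y.1 k)
      - (1 / 2 : ℝ) • (star (x.1 k) * qi * x.1 k) = _
    rw [hy, ← smul_sub, star_add]
    congr 1
    noncomm_ring
  change ‖((D.momentCoeff y k - D.momentCoeff x k : ImH) : ℍ[ℝ])‖ ≤ _
  rw [h1, norm_smul]
  have h2 := norm_add₃_le (a := star (x.1 k) * qi * v) (b := star v * qi * x.1 k)
    (c := star v * qi * v)
  simp only [norm_mul, Quaternion.norm_star, norm_qi] at h2
  norm_num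
  nlinarith

/-- For a fixed `t`, the moment map is the sum of a bounded linear and a bounded quadratic
function of the displacement. -/
theorem norm_moment_sub_le (x y : D.HilbertManifold) (t : D.LieT) :
    ‖D.moment y t - D.moment x t‖
      ≤ ‖t‖ * (√(4 + 2 * ‖D.toL2 x‖ ^ 2) * ‖D.toL2 y - D.toL2 x‖ + ‖D.toL2 y - D.toL2 x‖ ^ 2) := by
  set C := √(4 + 2 * ‖D.toL2 x‖ ^ 2) with hC
  have hC0 : 0 ≤ C := Real.sqrt_nonneg _
  set f : L → ℝ := fun k => √(1 + ‖D.lam k‖) * |D.coord t k| with hf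
  set d : L → ℝ := fun k => ‖y.1 k - x.1 k‖ with hd
  have hf2 : HasSum (fun k => f k ^ 2) (‖t‖ ^ 2) :=
    (D.hasSum_norm_lieT_sq t).congr_fun fun k => by
      rw [hf]; simp only [mul_pow, sq_abs, Real.sq_sqrt (by positivity : 0 ≤ 1 + ‖D.lam k‖)]
  have hd2 : HasSum (fun k => d k ^ 2) (‖D.toL2 y - D.toL2 x‖ ^ 2) := D.hasSum_norm_sub_sq y x
  have hf0 : ∀ k, 0 ≤ f k := fun k => by positivity
  have hd0 : ∀ k, 0 ≤ d k := fun k => norm_nonneg _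
  have hft : ∀ k, f k ≤ ‖t‖ := fun k =>
    le_of_sq_le_sq (le_hasSum hf2 k fun j _ => sq_nonneg _) (norm_nonneg _)
  obtain ⟨S, hS, hfd⟩ := exists_hasSum_mul_le hf0 hd0 (norm_nonneg _) (norm_nonneg _) hf2 hd2
  have hb : ∀ k, ‖D.coord t k • D.momentCoeff y k - D.coord t k • D.momentCoeff x k‖
      ≤ C * (f k * d k) + ‖t‖ * d k ^ 2 := fun k => by
    have h0 : D.coord t k • D.momentCoeff y k - D.coord t k • D.momentCoeff x k
        = D.coord t k • (D.momentCoeff y k - D.momentCoeff x k) := (smul_sub _ _ _).symm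
    rw [h0, norm_smul, Real.norm_eq_abs]
    have h1 := D.norm_momentCoeff_sub_le x y k
    have h2 : ‖x.1 k‖ ≤ C * √(1 + ‖D.lam k‖) := by
      rw [hC, ← Real.sqrt_mul (by positivity)]
      exact Real.le_sqrt_of_sq_le (D.norm_sq_le x k)
    have h3 : |D.coord t k| ≤ f k := by
      have : 1 ≤ √(1 + ‖D.lam k‖) := Real.one_le_sqrt.2 (by linarith [norm_nonneg (D.lam k)])
      exact le_mul_of_one_le_left (abs_nonneg _) this
    calc |D.coord t k| * ‖D.momentCoeff y k - D.momentCoeff x k‖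
        ≤ |D.coord t k| * (C * √(1 + ‖D.lam k‖) * d k + 1 / 2 * d k ^ 2) := by
          gcongr
          exact h1.trans (by gcongr)
      _ = C * (f k * d k) + 1 / 2 * (|D.coord t k| * d k ^ 2) := by rw [hf]; ring
      _ ≤ _ := by
        have := mul_le_mul_of_nonneg_right (h3.trans (hft k)) (sq_nonneg (d k))
        have : 0 ≤ |D.coord t k| * d k ^ 2 := by positivity
        linarith
  have hsum := ((D.summable_moment y t).hasSum.sub (D.summable_moment x t).hasSum)
  have hbd := (hfd.mul_left C).add (hd2.mul_left ‖t‖)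
  calc ‖D.moment y t - D.moment x t‖
      ≤ C * S + ‖t‖ * ‖D.toL2 y - D.toL2 x‖ ^ 2 := by
        have := tsum_of_norm_bounded hbd hb
        rwa [hsum.tsum_eq] at this
    _ ≤ C * (‖t‖ * ‖D.toL2 y - D.toL2 x‖) + ‖t‖ * ‖D.toL2 y - D.toL2 x‖ ^ 2 := by gcongr
    _ = _ := by ring

theorem isInducing_toL2 : Topology.IsInducing D.toL2 := ⟨rfl⟩

theorem continuous_moment (t : D.LieT) : Continuous fun x : D.HilbertManifold => D.moment x t := by
  rw [continuous_iff_continuousAt]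
  intro x
  rw [ContinuousAt, tendsto_iff_norm_sub_tendsto_zero]
  refine squeeze_zero (fun _ => norm_nonneg _) (fun y => D.norm_moment_sub_le x y t) ?_
  have h : Continuous fun y : D.HilbertManifold => ‖t‖ *
      (√(4 + 2 * ‖D.toL2 x‖ ^ 2) * ‖D.toL2 y - D.toL2 x‖ + ‖D.toL2 y - D.toL2 x‖ ^ 2) := by
    have := D.isInducing_toL2.continuous
    fun_prop
  simpa using h.tendsto x

end Data

/-! ### The moment map as an open map with orbit fibres -/

theorem eventually_mul_norm_sub_lt {F : Type*} [SeminormedAddCommGroup F] (c : F) (A K : ℝ) {ε : ℝ}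
    (hε : 0 < ε) : ∀ᶠ a in nhds c, A * ((‖a - c‖ + ‖a - c‖ ^ 2) * K) < ε := by
  have h : Continuous fun a : F => A * ((‖a - c‖ + ‖a - c‖ ^ 2) * K) := by fun_prop
  exact h.continuousAt.eventually_lt continuousAt_const (by simpa using hε)

namespace Data

variable (D : Data n L)

theorem eventually_lt_one_add_norm_lam (C : ℝ) : ∀ᶠ k in Filter.cofinite, C < 1 + ‖D.lam k‖ := by
  have hC : (0 : ℝ) < (|C| + 1)⁻¹ := by positivity
  filter_upwards [D.growth.tendsto_cofinite_zero.eventually (gt_mem_nhds hC)] with k hk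
  have h1 := (inv_lt_inv₀ (by positivity) (by positivity)).1 hk
  have h2 : |C| + 1 < 1 + ‖D.lam k‖ := h1
  linarith [le_abs_self C]

theorem eventually_one_add_norm_lam_le (x : D.HilbertManifold) :
    ∀ᶠ k in Filter.cofinite, 1 + ‖D.lam k‖ ≤ (2 + ‖D.toL2 x‖ ^ 2) * ‖x.1 k‖ ^ 2 := by
  filter_upwards [D.eventually_lt_one_add_norm_lam (2 * (2 + ‖D.toL2 x‖ ^ 2))] with k hk
  have h := D.one_add_norm_lam_le x k
  rw [norm_hopf] at h
  linarith

/-- A point of `M_Λ` has only finitely many vanishing coordinates, since `|Λ_k| → ∞`. -/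
theorem finite_zeros (x : D.HilbertManifold) : {k | x.1 k = 0}.Finite := by
  refine (Filter.eventually_cofinite.1 (D.eventually_one_add_norm_lam_le x)).subset fun k hk => ?_
  simp only [Set.mem_ofPred_eq] at hk ⊢
  rw [hk]
  simp
  positivity

/-- The fibres of the moment map are the orbits of `T_λ`. Where a coordinate of `x` vanishes the
element of the circle is arbitrary, and this happens only finitely often; elsewhere it is
controlled by `x` and `y`. -/
theorem exists_smul_eq {x y : D.HilbertManifold} (h : ∀ k, hopf (y.1 k) = hopf (x.1 k)) :
    ∃ g : D.group, g • x = y := by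
  choose g hg using fun k => exists_circle_mul_eq (h k)
  have hmem : g ∈ D.group := by
    change Summable fun k => (1 + ‖D.lam k‖) * ‖1 - (g k : ℂ)‖ ^ 2
    refine Summable.of_norm_bounded_eventually
      ((D.hasSum_norm_sub_sq y x).summable.mul_left (2 + ‖D.toL2 x‖ ^ 2)) ?_
    filter_upwards [D.eventually_one_add_norm_lam_le x] with k hk
    have h1 : ‖y.1 k - x.1 k‖ = ‖1 - (g k : ℂ)‖ * ‖x.1 k‖ := by
      rw [← norm_one_sub_circleToH, ← norm_mul, sub_mul, one_mul, hg]
    rw [Real.norm_of_nonneg (by positivity), h1]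
    nlinarith [mul_le_mul_of_nonneg_right hk (sq_nonneg ‖1 - (g k : ℂ)‖)]
  exact ⟨⟨g, hmem⟩, Subtype.ext (funext hg)⟩

/-- The base point `Λ` of `M_Λ`. -/
def basePoint : D.HilbertManifold := ⟨D.Λ, memlp_two_iff.2 (by simp [summable_zero])⟩

namespace Beta

variable {D} (b : D.Beta)

theorem hasSum_coord_smul_uR (t : D.LieT) :
    HasSum (fun k => D.coord t k • D.uR k) (b.toCLM t) := by
  refine ((D.hasSum_coord_smul_e t).mapL b.toCLM).congr_fun fun k => ?_
  rw [map_smul, b.map_e]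

/-- By continuity of `β`, the vectors `u_k` are square summable for the weights `(1 + |λ_k|)⁻¹`:
it suffices to test `β` on `∑ (1 + |λ_k|)⁻¹ u_{k,i} e_k` over finite sets. -/
theorem summable_norm_uR_sq (b : D.Beta) : Summable fun k => ‖D.uR k‖ ^ 2 * (1 + ‖D.lam k‖)⁻¹ := by
  classical
  have key : ∀ i, Summable fun k => (D.uR k i) ^ 2 * (1 + ‖D.lam k‖)⁻¹ := fun i => by
    refine summable_of_sum_le (c := ‖b.toCLM‖ ^ 2) (fun k => by positivity) fun F => ?_
    set S := ∑ k ∈ F, (D.uR k i) ^ 2 * (1 + ‖D.lam k‖)⁻¹ with hS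
    have hS0 : 0 ≤ S := Finset.sum_nonneg fun k _ => by positivity
    set t : D.LieT := ∑ k ∈ F, (D.uR k i * (1 + ‖D.lam k‖)⁻¹) • D.e k with ht
    have hc : ∀ j, D.coord t j = if j ∈ F then D.uR j i * (1 + ‖D.lam j‖)⁻¹ else 0 := fun j => by
      rw [ht, map_sum, Finset.sum_apply]
      simp [coord_e]
    have ht2 : ‖t‖ ^ 2 = S := by
      rw [← (D.hasSum_norm_lieT_sq t).tsum_eq, tsum_eq_sum (s := F)]
      · refine Finset.sum_congr rfl fun k hk => ?_
        have : 1 + ‖D.lam k‖ ≠ 0 := by positivity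
        rw [hc, if_pos hk]
        field_simp
      · intro k hk
        rw [hc, if_neg hk]
        ring
    have hb : b.toCLM t i = S := by
      rw [ht, map_sum, Finset.sum_apply]
      refine Finset.sum_congr rfl fun k _ => ?_
      rw [map_smul, b.map_e, Pi.smul_apply, smul_eq_mul]
      ring
    have h1 : S ≤ ‖b.toCLM‖ * ‖t‖ := by
      rw [← hb]
      exact (le_abs_self _).trans ((norm_le_pi_norm (b.toCLM t) i).trans (b.toCLM.le_opNorm t))
    rw [← ht2] at h1 ⊢
    have h2 : ‖t‖ ≤ ‖b.toCLM‖ := by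
      rcases (norm_nonneg t).eq_or_lt with h | h
      · rw [← h]; exact norm_nonneg _
      · nlinarith
    exact pow_le_pow_left₀ (norm_nonneg _) h2 2
  refine Summable.of_nonneg_of_le (fun k => by positivity) (fun k => ?_)
    (summable_sum fun i (_ : i ∈ Finset.univ) => key i)
  rw [← Finset.sum_mul]
  refine mul_le_mul_of_nonneg_right ?_ (by positivity)
  have h0 : 0 ≤ ∑ i, (D.uR k i) ^ 2 := Finset.sum_nonneg fun i _ => sq_nonneg _
  rw [← Real.sqrt_le_sqrt_iff h0, Real.sqrt_sq (norm_nonneg _)]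
  refine (pi_norm_le_iff_of_nonneg (Real.sqrt_nonneg _)).2 fun i => ?_
  rw [Real.norm_eq_abs]
  exact Real.abs_le_sqrt (Finset.single_le_sum (f := fun i => (D.uR k i) ^ 2)
    (fun j _ => sq_nonneg _) (Finset.mem_univ i))

/-- A point of `M_Λ` can be moved so that its moment value changes by `a`, with a bound on the
distance which tends to zero with `a`. -/
theorem exists_hopf_eq_add_apply (b : D.Beta) : ∃ K : ℝ, ∀ (x : D.HilbertManifold) (a : Target n),
    ∃ y : D.HilbertManifold, (∀ k, hopf (y.1 k) = hopf (x.1 k) + a (D.uR k)) ∧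
      ‖D.toL2 y - D.toL2 x‖ ^ 2 ≤ 2 * (2 + ‖D.toL2 x‖ ^ 2) * ((‖a‖ + ‖a‖ ^ 2) * K) := by
  have hs : Summable fun k => (1 + ‖D.uR k‖ ^ 2) * (1 + ‖D.lam k‖)⁻¹ := by
    refine (D.growth.add b.summable_norm_uR_sq).congr fun k => ?_
    change (1 + ‖D.lam k‖)⁻¹ + _ = _
    ring
  refine ⟨∑' k, (1 + ‖D.uR k‖ ^ 2) * (1 + ‖D.lam k‖)⁻¹, fun x a => ?_⟩
  have hle : ∀ k, (‖a (D.uR k)‖ + ‖a (D.uR k)‖ ^ 2) * (1 + ‖D.lam k‖)⁻¹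
      ≤ (‖a‖ + ‖a‖ ^ 2) * ((1 + ‖D.uR k‖ ^ 2) * (1 + ‖D.lam k‖)⁻¹) := fun k => by
    rw [← mul_assoc]
    refine mul_le_mul_of_nonneg_right ?_ (by positivity)
    have h1 := a.le_opNorm (D.uR k)
    have h2 : ‖a (D.uR k)‖ ^ 2 ≤ (‖a‖ * ‖D.uR k‖) ^ 2 := pow_le_pow_left₀ (norm_nonneg _) h1 2
    have h3 : ‖a‖ * ‖D.uR k‖ ≤ ‖a‖ * (1 + ‖D.uR k‖ ^ 2) :=
      mul_le_mul_of_nonneg_left (by nlinarith [sq_nonneg (‖D.uR k‖ - 1)]) (norm_nonneg a)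
    nlinarith [sq_nonneg ‖a‖]
  have hη := Summable.of_nonneg_of_le (fun k => by positivity) hle (hs.mul_left _)
  obtain ⟨y, hy, hd⟩ := D.exists_hopf_eq_dist_sq_le x (fun k => a (D.uR k)) hη
  refine ⟨y, hy, hd.trans (mul_le_mul_of_nonneg_left ?_ (by positivity))⟩
  rw [← tsum_mul_left]
  exact hη.tsum_le_tsum hle (hs.mul_left _)

theorem phiZero_toCLM (x : b.ZeroSet) (t : D.LieT) :
    b.phiZero x (b.toCLM t) = D.moment x.1 t := by
  have : (b.toCLM.toLinearMap.quotKerEquivOfSurjective b.surjective).symm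
      (b.toCLM t) = Submodule.Quotient.mk t := by
    rw [LinearEquiv.symm_apply_eq]; rfl
  simp only [phiZero, LinearMap.coe_toContinuousLinearMap', LinearMap.comp_apply,
    LinearEquiv.coe_coe, this]
  rfl

theorem phiZero_uR (x : b.ZeroSet) (k : L) :
    b.phiZero x (D.uR k) = D.lam k + hopf (x.1.1 k) := by
  rw [← b.map_e, phiZero_toCLM, moment_e]
  rfl

theorem phiZero_mem_flat_iff (x : b.ZeroSet) (k : L) :
    b.phiZero x ∈ D.flat k ↔ x.1.1 k = 0 := by
  change b.phiZero x (D.uR k) = D.lam k ↔ _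
  rw [phiZero_uR, add_eq_left, hopf_eq_zero_iff]

/-- It suffices to check the moment equation on the vectors `e_k`, because `β` is continuous. -/
theorem exists_zeroSet_of_momentCoeff_eq {x : D.HilbertManifold} {a : Target n}
    (h : ∀ k, D.lam k + hopf (x.1 k) = a (D.uR k)) :
    ∃ z : b.ZeroSet, z.1 = x ∧ b.phiZero z = a := by
  have hm : ∀ t, D.moment x t = a (b.toCLM t) := fun t => by
    have h1 := (b.hasSum_coord_smul_uR t).mapL a
    rw [← h1.tsum_eq]
    refine tsum_congr fun k => ?_
    rw [map_smul, ← h k]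
    rfl
  refine ⟨⟨x, fun t ht => ?_⟩, rfl, ?_⟩
  · have : b.toCLM t = 0 := ht
    rw [hm, this, map_zero]
  · ext1 v
    obtain ⟨t, rfl⟩ := b.surjective v
    exact (b.phiZero_toCLM _ t).trans (hm t)

theorem phiZero_surjective : Function.Surjective b.phiZero := by
  intro a
  obtain ⟨K, hK⟩ := b.exists_hopf_eq_add_apply
  obtain ⟨y, hy, -⟩ := hK D.basePoint a
  obtain ⟨z, -, hz⟩ := b.exists_zeroSet_of_momentCoeff_eq (x := y) (a := a) fun k => by
    rw [hy k]
    exact neg_add_cancel_left (hopf (D.Λ k)) _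
  exact ⟨z, hz⟩

theorem phiZero_eq_iff {x y : b.ZeroSet} :
    b.phiZero x = b.phiZero y ↔ ∃ g : D.group, g • y = x := by
  constructor
  · intro h
    obtain ⟨g, hg⟩ := D.exists_smul_eq (x := y.1) (y := x.1) fun k => by
      have h1 := b.phiZero_uR x k
      rw [h, b.phiZero_uR] at h1
      exact (add_left_cancel h1).symm
    exact ⟨g, Subtype.ext hg⟩
  · rintro ⟨g, rfl⟩
    ext1 v
    obtain ⟨t, rfl⟩ := b.surjective v
    exact (b.phiZero_toCLM _ t).trans
      ((LinearMap.congr_fun (D.moment_smul g y.1) t).trans (b.phiZero_toCLM _ t).symm)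

theorem continuous_phiZero : Continuous b.phiZero := by
  refine continuous_clm_apply.2 fun v => ?_
  obtain ⟨t, rfl⟩ := b.surjective v
  have h : Continuous fun x : b.ZeroSet => D.moment x.1 t :=
    (D.continuous_moment t).comp continuous_subtype_val
  exact h.congr fun x => (b.phiZero_toCLM x t).symm

theorem isOpenMap_phiZero : IsOpenMap b.phiZero := by
  rw [isOpenMap_iff_nhds_le]
  intro x V hV
  obtain ⟨K, hK⟩ := b.exists_hopf_eq_add_apply
  have hind : Topology.IsInducing fun y : b.ZeroSet => D.toL2 y.1 :=
    D.isInducing_toL2.comp Topology.IsInducing.subtypeVal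
  rw [Filter.mem_map, hind.nhds_eq_comap] at hV
  obtain ⟨U, hU, hUV⟩ := hV
  obtain ⟨ε, hε, hball⟩ := Metric.mem_nhds_iff.1 hU
  have hev : ∀ᶠ a in nhds (b.phiZero x), 2 * (2 + ‖D.toL2 x.1‖ ^ 2) *
      ((‖a - b.phiZero x‖ + ‖a - b.phiZero x‖ ^ 2) * K) < ε ^ 2 :=
    eventually_mul_norm_sub_lt (b.phiZero x) _ K (pow_pos hε 2)
  filter_upwards [hev] with a ha
  obtain ⟨y, hy, hd⟩ := hK x.1 (a - b.phiZero x)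
  obtain ⟨z, hz, rfl⟩ := b.exists_zeroSet_of_momentCoeff_eq (x := y) (a := a) fun k => by
    have h1 := b.phiZero_uR x k
    have h2 : (a - b.phiZero x) (D.uR k) = a (D.uR k) - b.phiZero x (D.uR k) := rfl
    rw [hy k, h2, h1]
    abel
  refine hUV (hball ?_)
  change dist (D.toL2 z.1) (D.toL2 x.1) < ε
  rw [dist_eq_norm, show z.1 = y from hz]
  exact lt_of_pow_lt_pow_left₀ 2 hε.le (hd.trans_lt ha)

end Beta

end Data

/-! ### The quotient topology and connectedness -/

theorem norm_circleToH_exp_sub_le (s t : ℝ) :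
    ‖circleToH (Circle.exp s) - circleToH (Circle.exp t)‖ ≤ |s - t| := by
  have h1 : circleToH (Circle.exp s) - circleToH (Circle.exp t)
      = circleToH (Circle.exp t) * (circleToH (Circle.exp (s - t)) - 1) := by
    rw [mul_sub, ← circleToH_mul, ← Circle.exp_add, add_sub_cancel, mul_one]
  rw [h1, norm_mul, norm_circleToH, one_mul, norm_one_sub_circleToH]
  exact abs_le_of_sq_le_sq' (by rw [sq_abs]; exact norm_one_sub_exp_sq_le _) (abs_nonneg _) |>.2

namespace Data

variable (D : Data n L)

theorem continuous_lieExp_smul (x : D.HilbertManifold) :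
    Continuous fun t : D.LieT => D.lieExp t • x := by
  rw [D.isInducing_toL2.continuous_iff]
  refine (LipschitzWith.of_dist_le' (K := √(4 + 2 * ‖D.toL2 x‖ ^ 2)) fun s t => ?_).continuous
  rw [dist_eq_norm, dist_eq_norm]
  have h0 : 0 ≤ 4 + 2 * ‖D.toL2 x‖ ^ 2 := by positivity
  refine le_of_sq_le_sq ?_ (by positivity)
  rw [mul_pow, Real.sq_sqrt h0]
  refine hasSum_le (fun k => ?_) (D.hasSum_norm_sub_sq (D.lieExp s • x) (D.lieExp t • x))
    ((D.hasSum_norm_lieT_sq (s - t)).mul_left _)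
  change ‖circleToH (Circle.exp (D.coord s k)) * x.1 k
    - circleToH (Circle.exp (D.coord t k)) * x.1 k‖ ^ 2 ≤ _
  have h1 : D.coord (s - t) k = D.coord s k - D.coord t k := by rw [map_sub]; rfl
  rw [← sub_mul, norm_mul, mul_pow, h1, ← sq_abs (D.coord s k - D.coord t k)]
  calc _ ≤ |D.coord s k - D.coord t k| ^ 2 *
        ((4 + 2 * ‖D.toL2 x‖ ^ 2) * (1 + ‖D.lam k‖)) :=
        mul_le_mul (pow_le_pow_left₀ (norm_nonneg _) (norm_circleToH_exp_sub_le _ _) 2)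
          (D.norm_sq_le x k) (by positivity) (by positivity)
    _ = _ := by ring

namespace Beta

variable {D} (b : D.Beta)

/-- The moment map is a quotient map onto a vector space, and its fibres are the orbits of `T_λ`,
which are continuous images of the vector space `𝔱_λ`. -/
theorem connectedSpace_zeroSet : ConnectedSpace b.ZeroSet := by
  have hfib : ∀ a, IsConnected (b.phiZero ⁻¹' {a}) := fun a => by
    obtain ⟨x, rfl⟩ := b.phiZero_surjective a
    have hc : Continuous fun t : D.LieT => D.lieExp t • x :=
      Continuous.subtype_mk (D.continuous_lieExp_smul x.1) fun t => (D.lieExp t • x).2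
    have : b.phiZero ⁻¹' {b.phiZero x} = Set.range fun t : D.LieT => D.lieExp t • x := by
      ext y
      rw [Set.mem_preimage, Set.mem_singleton_iff, phiZero_eq_iff]
      constructor
      · rintro ⟨g, rfl⟩
        exact ⟨D.lieLog g, by simp only [D.lieExp_lieLog]⟩
      · rintro ⟨t, rfl⟩
        exact ⟨D.lieExp t, rfl⟩
    rw [this]
    exact isConnected_range hc
  have hq := b.isOpenMap_phiZero.isQuotientMap b.continuous_phiZero b.phiZero_surjective
  have := hq.isCoinducing.isConnected_preimage_of_isClosed hfib isClosed_univ isConnected_univ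
  rwa [Set.preimage_univ, ← connectedSpace_iff_univ] at this

theorem continuous_proj : Continuous b.proj := continuous_quot_mk

theorem proj_surjective : Function.Surjective b.proj := Quot.mk_surjective

theorem connectedSpace_M : ConnectedSpace b.M :=
  have := b.connectedSpace_zeroSet
  b.proj_surjective.connectedSpace b.continuous_proj

theorem phi_proj (x : b.ZeroSet) : b.phi (b.proj x) = b.phiZero x := rfl

theorem phi_eq_iff {p q : b.M} : b.phi p = b.phi q ↔ ∃ τ : Torus n, τ • q = p := by
  obtain ⟨x, rfl⟩ := b.proj_surjective p
  obtain ⟨y, rfl⟩ := b.proj_surjective q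
  rw [phi_proj, phi_proj, phiZero_eq_iff]
  constructor
  · rintro ⟨g, rfl⟩
    exact ⟨b.hom g, b.hom_smul_proj g y⟩
  · rintro ⟨τ, h⟩
    obtain ⟨g, rfl⟩ := b.hom_surjective τ
    rw [hom_smul_proj] at h
    obtain ⟨m, hm⟩ := Quotient.exact h
    exact ⟨m.1⁻¹ * g, by rw [mul_smul, inv_smul_eq_iff]; exact hm.symm⟩

/-- The map induced by the moment map on the orbit space. -/
noncomputable def phiOrbit : b.OrbitSpace → Target n :=
  Quotient.lift (s := MulAction.orbitRel (Torus n) b.M) b.phi fun _ _ h => b.phi_eq_iff.2 h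

theorem phiOrbit_bijective : Function.Bijective b.phiOrbit := by
  constructor
  · rintro ⟨p⟩ ⟨q⟩ h
    exact Quotient.sound (s := MulAction.orbitRel (Torus n) b.M) (b.phi_eq_iff.1 h)
  · intro a
    obtain ⟨x, rfl⟩ := b.phiZero_surjective a
    exact ⟨Quotient.mk _ (b.proj x), rfl⟩

theorem continuous_phi : Continuous b.phi := b.continuous_phiZero.quotient_lift _

theorem continuous_phiOrbit : Continuous b.phiOrbit := b.continuous_phi.quotient_lift _

theorem isOpenMap_phiOrbit : IsOpenMap b.phiOrbit := by
  have hq : Continuous fun x : b.ZeroSet =>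
      (Quotient.mk (MulAction.orbitRel (Torus n) b.M) (b.proj x) : b.OrbitSpace) :=
    continuous_quot_mk.comp b.continuous_proj
  intro U hU
  convert b.isOpenMap_phiZero _ (hU.preimage hq) using 1
  ext a
  constructor
  · rintro ⟨⟨p⟩, hp, rfl⟩
    obtain ⟨x, rfl⟩ := b.proj_surjective p
    exact ⟨x, hp, rfl⟩
  · rintro ⟨x, hx, rfl⟩
    exact ⟨_, hx, rfl⟩

/-- The homeomorphism of the orbit space with `Im ℍ ⊗ (ℝⁿ)^*`. -/
noncomputable def orbitHomeomorph : b.OrbitSpace ≃ₜ Target n :=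
  (Equiv.ofBijective b.phiOrbit b.phiOrbit_bijective).toHomeomorphOfContinuousOpen
    b.continuous_phiOrbit b.isOpenMap_phiOrbit

end Beta

end Data

/-! ### The dimension of the target -/

/-- The imaginary quaternions in coordinates. -/
def imHEquiv : ImH ≃ₗ[ℝ] (Fin 3 → ℝ) where
  toFun q := ![(q : ℍ[ℝ]).imI, (q : ℍ[ℝ]).imJ, (q : ℍ[ℝ]).imK]
  map_add' p q := by ext i; fin_cases i <;> simp
  map_smul' c q := by ext i; fin_cases i <;> simp
  invFun v := ⟨⟨0, v 0, v 1, v 2⟩, rfl⟩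
  left_inv q := Subtype.ext (Quaternion.ext _ _ q.2.symm rfl rfl rfl)
  right_inv v := by ext i; fin_cases i <;> rfl

theorem nonempty_continuousLinearMap_equiv (n m : ℕ) {F : Type*} [NormedAddCommGroup F]
    [NormedSpace ℝ F] (e : F ≃ₗ[ℝ] (Fin m → ℝ)) :
    Nonempty (((Fin n → ℝ) →L[ℝ] F) ≃L[ℝ] EuclideanSpace ℝ (Fin (m * n))) := by
  have : FiniteDimensional ℝ F := Module.Finite.equiv e.symm
  have f : ((Fin n → ℝ) →ₗ[ℝ] F) ≃ₗ[ℝ] ((Fin n → ℝ) →L[ℝ] F) := LinearMap.toContinuousLinearMap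
  have : FiniteDimensional ℝ ((Fin n → ℝ) →L[ℝ] F) := Module.Finite.equiv f
  refine ⟨ContinuousLinearEquiv.ofFinrankEq ?_⟩
  rw [← f.finrank_eq, Module.finrank_linearMap, e.finrank_eq, finrank_euclideanSpace_fin]
  simp [mul_comm]

/-! ### Stabilisers -/

theorem continuous_torusExp : Continuous (torusExp : (Fin n → ℝ) → Torus n) :=
  continuous_pi fun i => Circle.exp.continuous.comp (continuous_apply i)

/-- The Lie algebra of the image of a subspace `V` is `V`: if the line through `v` is contained in
`V + 2πℤⁿ`, two of its points differ by an element of `V` since `ℤⁿ` is countable. -/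
theorem lieAlgebra_eq_of_coe_eq_image {H : Subgroup (Torus n)} {V : Submodule ℝ (Fin n → ℝ)}
    (h : (H : Set (Torus n)) = torusExp '' V) : lieAlgebra H = V := by
  have hmem : ∀ τ, τ ∈ H ↔ ∃ w ∈ V, torusExp w = τ := fun τ => by
    rw [← SetLike.mem_coe, h]; rfl
  ext v
  constructor
  · intro hv
    choose w hw hwv using fun s : ℝ => (hmem _).1 (hv s)
    choose m hm using fun (s : ℝ) (i : Fin n) => Circle.exp_eq_exp.1 (congrFun (hwv s) i)
    have hinj : ¬ Function.Injective m := fun hi =>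
      not_countable (α := ℝ) hi.countable
    simp only [Function.Injective, not_forall] at hinj
    obtain ⟨s, t, hst, hne⟩ := hinj
    have h1 : w s - w t = (s - t) • v := by
      ext i
      have h2 := hm s i
      have h3 := hm t i
      rw [hst] at h2
      simp only [Pi.sub_apply, Pi.smul_apply, smul_eq_mul] at h2 h3 ⊢
      linarith
    have h4 : (s - t) • v ∈ V := h1 ▸ V.sub_mem (hw s) (hw t)
    exact (V.smul_mem_iff (sub_ne_zero.2 hne)).1 h4
  · intro hv s
    exact (hmem _).2 ⟨s • v, V.smul_mem s hv, rfl⟩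

namespace Data

variable {D : Data n L}

theorem smul_eq_self_iff {g : D.group} {x : D.HilbertManifold} :
    g • x = x ↔ ∀ k, x.1 k ≠ 0 → g.1 k = 1 := by
  have h : ∀ k, circleToH (g.1 k) * x.1 k = x.1 k ↔ (x.1 k ≠ 0 → g.1 k = 1) := fun k => by
    constructor
    · intro h1 h2
      have h3 : circleToH (g.1 k) - 1 = 0 := by
        rw [mul_eq_right₀ h2] at h1
        rw [h1, sub_self]
      rw [← norm_eq_zero, norm_one_sub_circleToH, norm_eq_zero, sub_eq_zero] at h3
      exact Circle.ext h3.symm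
    · intro h1
      by_cases h2 : x.1 k = 0
      · rw [h2, mul_zero]
      · rw [h1 h2, circleToH_one, one_mul]
  rw [← forall_congr' h]
  exact ⟨fun h k => congrFun (congrArg Subtype.val h) k, fun h => Subtype.ext (funext h)⟩

namespace Beta

variable (b : D.Beta)

theorem mem_stabilizer_proj_iff {x : b.ZeroSet} {τ : Torus n} :
    τ ∈ MulAction.stabilizer (Torus n) (b.proj x) ↔ ∃ g : D.group, g • x = x ∧ b.hom g = τ := by
  rw [MulAction.mem_stabilizer_iff]
  constructor
  · intro h
    obtain ⟨g, rfl⟩ := b.hom_surjective τ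
    rw [hom_smul_proj] at h
    obtain ⟨m, hm⟩ := Quotient.exact h
    refine ⟨m.1⁻¹ * g, by rw [mul_smul, inv_smul_eq_iff]; exact hm.symm, ?_⟩
    have h1 : b.hom m.1 = 1 := m.2
    rw [map_mul, map_inv, h1, inv_one, one_mul]
  · rintro ⟨g, hg, rfl⟩
    rw [hom_smul_proj, hg]

theorem toCLM_eq_sum {t : D.LieT} {F : Finset L} (ht : ∀ k ∉ F, D.coord t k = 0) :
    b.toCLM t = ∑ k ∈ F, D.coord t k • D.uR k := by
  rw [← (b.hasSum_coord_smul_uR t).tsum_eq]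
  exact tsum_eq_sum fun k hk => by rw [ht k hk, zero_smul]

/-- The stabiliser of the class of `x` is the image of the finite-dimensional torus of those
coordinates in which `x` vanishes. The bounded parameters exhibit it as a compact set, the unbounded
ones as the exponential of a subspace. -/
theorem mem_stabilizer_proj_tfae (x : b.ZeroSet) (τ : Torus n) :
    List.TFAE [τ ∈ MulAction.stabilizer (Torus n) (b.proj x),
      ∃ c ∈ Set.univ.pi fun _ : L => Set.Icc (-Real.pi) Real.pi,
        torusExp (∑ k ∈ (D.finite_zeros x.1).toFinset, c k • D.uR k) = τ,
      ∃ c : L → ℝ, torusExp (∑ k ∈ (D.finite_zeros x.1).toFinset, c k • D.uR k) = τ] := by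
  classical
  tfae_have 1 → 2 := by
    rw [mem_stabilizer_proj_iff]
    rintro ⟨g, hg, rfl⟩
    have hg' : ∀ k, x.1.1 k ≠ 0 → g.1 k = 1 := smul_eq_self_iff.1 (congrArg Subtype.val hg)
    refine ⟨D.coord (D.lieLog g), fun k _ => ?_, ?_⟩
    · exact ⟨(Complex.neg_pi_lt_arg _).le, Complex.arg_le_pi _⟩
    · rw [← b.toCLM_eq_sum, ← hom_lieExp, lieExp_lieLog]
      intro k hk
      have h1 : x.1.1 k ≠ 0 := by simpa using hk
      change Complex.arg (g.1 k) = 0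
      rw [hg' k h1, Circle.coe_one, Complex.arg_one]
  tfae_have 2 → 3 := fun ⟨c, _, h⟩ => ⟨c, h⟩
  tfae_have 3 → 1 := by
    rintro ⟨c, rfl⟩
    set F := (D.finite_zeros x.1).toFinset with hF
    set t : D.LieT := ∑ k ∈ F, c k • D.e k with ht
    have hc : ∀ j, D.coord t j = if j ∈ F then c j else 0 := fun j => by
      rw [ht, map_sum, Finset.sum_apply]
      simp [coord_e]
    have hb : b.toCLM t = ∑ k ∈ F, c k • D.uR k := by
      rw [ht, map_sum]
      exact Finset.sum_congr rfl fun k _ => by rw [map_smul, b.map_e]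
    rw [mem_stabilizer_proj_iff]
    refine ⟨D.lieExp t, Subtype.ext (smul_eq_self_iff.2 fun k hk => ?_), ?_⟩
    · change Circle.exp (D.coord t k) = 1
      rw [hc, if_neg (by simpa [hF] using hk), Circle.exp_zero]
    · rw [hom_lieExp, hb]
  tfae_finish

theorem continuous_torusExp_sum (D : Data n L) (F : Finset L) :
    Continuous fun c : L → ℝ => torusExp (∑ k ∈ F, c k • D.uR k) := by
  refine continuous_torusExp.comp ?_
  fun_prop

theorem isSubtorus_stabilizer (p : b.M) : IsSubtorus (MulAction.stabilizer (Torus n) p) := by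
  obtain ⟨x, rfl⟩ := b.proj_surjective p
  have hcont := continuous_torusExp_sum D (D.finite_zeros x.1).toFinset
  constructor
  · have h : (MulAction.stabilizer (Torus n) (b.proj x) : Set (Torus n)) =
        (fun c : L → ℝ => torusExp (∑ k ∈ (D.finite_zeros x.1).toFinset, c k • D.uR k)) ''
          Set.univ.pi fun _ : L => Set.Icc (-Real.pi) Real.pi :=
      Set.ext fun τ => (b.mem_stabilizer_proj_tfae x τ).out 0 1
    rw [h]
    exact ((isCompact_univ_pi fun _ => isCompact_Icc).image hcont).isClosed
  · have h : (MulAction.stabilizer (Torus n) (b.proj x) : Set (Torus n)) =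
        Set.range (fun c : L → ℝ =>
          torusExp (∑ k ∈ (D.finite_zeros x.1).toFinset, c k • D.uR k)) :=
      Set.ext fun τ => (b.mem_stabilizer_proj_tfae x τ).out 0 2
    rw [h]
    exact isConnected_range hcont

theorem lieAlgebra_stabilizer (p : b.M) :
    lieAlgebra (MulAction.stabilizer (Torus n) p) =
      (Submodule.span ℝ {v | ∃ k, b.phi p ∈ D.flat k ∧ v = D.uR k} : Set (Fin n → ℝ)) := by
  obtain ⟨x, rfl⟩ := b.proj_surjective p
  refine lieAlgebra_eq_of_coe_eq_image (Set.ext fun τ => ?_)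
  refine ((b.mem_stabilizer_proj_tfae x τ).out 0 2).trans ?_
  have hset : {v | ∃ k, b.phi (b.proj x) ∈ D.flat k ∧ v = D.uR k}
      = D.uR '' ((D.finite_zeros x.1).toFinset : Set L) := by
    ext v
    simp only [phi_proj, phiZero_mem_flat_iff, Set.Finite.coe_toFinset, Set.mem_image,
      Set.mem_ofPred_eq, eq_comm]
  have hspan : ∀ v, v ∈ Submodule.span ℝ (D.uR '' ((D.finite_zeros x.1).toFinset : Set L)) ↔
      ∃ c : L → ℝ, ∑ k ∈ (D.finite_zeros x.1).toFinset, c k • D.uR k = v := fun v =>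
    Submodule.mem_span_image_finset_iff_exists_fun' ℝ
  rw [hset]
  constructor
  · rintro ⟨c, rfl⟩
    exact ⟨_, (hspan _).2 ⟨c, rfl⟩, rfl⟩
  · rintro ⟨v, hv, rfl⟩
    obtain ⟨c, rfl⟩ := (hspan v).1 hv
    exact ⟨c, rfl⟩

end Beta

end Data

/-! ### Existence of `β` -/

namespace Data

variable (D : Data n L)

theorem exists_linearIndependent_uR :
    ∃ κ : Fin n → L, LinearIndependent ℝ fun i => D.uR (κ i) := by
  obtain ⟨ι, a, -, hspan, hli⟩ := exists_linearIndependent' ℝ D.uR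
  have htop : Submodule.span ℝ (Set.range (D.uR ∘ a)) = ⊤ := hspan.trans D.u_span
  let B := Module.Basis.mk hli htop.ge
  have : Fintype ι := FiniteDimensional.fintypeBasisIndex B
  have hcard : Fintype.card ι = n := by
    rw [← Module.finrank_eq_card_basis B, Module.finrank_fin_fun]
  let f : Fin n ≃ ι := (Fintype.equivFinOfCardEq hcard).symm
  exact ⟨a ∘ f, hli.comp f f.injective⟩

/-- A family of `n` linearly independent `u_k` gives `n` distinct flats with a common point. -/
theorem FlatsUnimodular.span_eq_top {D : Data n L} (hD : D.FlatsUnimodular) {κ : Fin n → L}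
    (hκ : LinearIndependent ℝ fun i => D.uR (κ i)) :
    Submodule.span ℤ (Set.range fun i => D.u (κ i)) = ⊤ := by
  classical
  let B := basisOfLinearIndependentOfCardEqFinrank' _ hκ (by simp)
  have hB : ∀ i, B i = D.uR (κ i) := fun i => by simp [B]
  have hex : ∀ c : Fin n → ImH, ∃ a : Target n, ∀ i, a (D.uR (κ i)) = c i := fun c =>
    ⟨LinearMap.toContinuousLinearMap (B.constr ℝ c), fun i => by
      rw [← hB]; exact B.constr_basis ℝ c i⟩
  refine (hD κ (fun i j hij => ?_) ?_).2
  · by_contra hne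
    obtain ⟨ξ, hξ⟩ : ∃ ξ : ImH, ξ ≠ 0 := ⟨hopf 1, by simp [hopf_eq_zero_iff]⟩
    -- a point of the `i`-th flat which misses the `j`-th one
    obtain ⟨a, ha⟩ := hex (Function.update (fun l => D.lam (κ l)) j (D.lam (κ j) + ξ))
    have h1 : a ∈ D.flat (κ i) := by
      change a (D.uR (κ i)) = _
      rw [ha, Function.update_of_ne hne]
    have h2 : a ∈ D.flat (κ j) := by
      have hij' : D.flat (κ i) = D.flat (κ j) := hij
      rwa [hij'] at h1
    have h3 : a (D.uR (κ j)) = D.lam (κ j) := h2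
    rw [ha, Function.update_self, add_eq_left] at h3
    exact hξ h3
  · obtain ⟨a, ha⟩ := hex fun l => D.lam (κ l)
    exact ⟨a, Set.mem_iInter.2 ha⟩

/-- With respect to a basis consisting of some `u_k`, all the `u_k` have coordinates in
`[-1, 1]`: if the `i`-th coordinate of `u_k` is not zero, then `u_k` can replace the `i`-th basis
vector, which is therefore an integral combination of the new ones. -/
theorem FlatsUnimodular.abs_repr_le {D : Data n L} (hD : D.FlatsUnimodular) {κ : Fin n → L}
    (B : Module.Basis (Fin n) ℝ (Fin n → ℝ)) (hB : ∀ i, B i = D.uR (κ i)) (k : L) (i : Fin n) :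
    |B.repr (D.uR k) i| ≤ 1 := by
  classical
  by_cases hc : B.repr (D.uR k) i = 0
  · rw [hc, abs_zero]; exact zero_le_one
  set κ' := Function.update κ i k with hκ'
  have hrepr : ∀ j l, j ≠ i → B.repr (D.uR (κ' j)) l = if l = j then 1 else 0 := fun j l hj => by
    rw [hκ', Function.update_of_ne hj, ← hB, B.repr_self, Finsupp.single_apply]
    simp only [eq_comm]
  have hreprI : D.uR (κ' i) = D.uR k := by rw [hκ', Function.update_self]
  have hli : LinearIndependent ℝ fun j => D.uR (κ' j) := by
    rw [Fintype.linearIndependent_iff]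
    intro g hg
    have hl : ∀ l, ∑ j, g j * B.repr (D.uR (κ' j)) l = 0 := fun l => by
      have := congrArg (fun v => B.repr v l) hg
      simpa [Finsupp.finsetSum_apply] using this
    have hgi : g i = 0 := by
      have h1 := hl i
      rw [Finset.sum_eq_single i (fun j _ hj => by rw [hrepr j i hj, if_neg hj.symm, mul_zero])
        (by simp), hreprI] at h1
      exact (mul_eq_zero.1 h1).resolve_right hc
    intro l
    by_cases hli : l = i
    · rw [hli, hgi]
    have h1 := hl l
    rw [Finset.sum_eq_single l (fun j _ hj => ?_) (by simp), hrepr l l hli, if_pos rfl,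
      mul_one] at h1
    · exact h1
    · by_cases hji : j = i
      · rw [hji, hgi, zero_mul]
      · rw [hrepr j l hji, if_neg hj.symm, mul_zero]
  have hmem : D.u (κ i) ∈ Submodule.span ℤ (Set.range fun j => D.u (κ' j)) := by
    rw [hD.span_eq_top hli]; trivial
  obtain ⟨m, hm⟩ := (Submodule.mem_span_range_iff_exists_fun ℤ).1 hmem
  have hmR : ∑ j, (m j : ℝ) • D.uR (κ' j) = B i := by
    rw [hB]
    funext l
    have := congrArg (fun v : Fin n → ℤ => ((v l : ℤ) : ℝ)) hm
    simpa [uR, toReal, Finset.sum_apply] using this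
  have h1 : (m i : ℝ) * B.repr (D.uR k) i = 1 := by
    have h2 := congrArg (fun v => B.repr v i) hmR
    simp only [map_sum, map_smul, Finsupp.finsetSum_apply, Finsupp.smul_apply, smul_eq_mul,
      B.repr_self, Finsupp.single_eq_same] at h2
    rwa [Finset.sum_eq_single i (fun j _ hj => by rw [hrepr j i hj, if_neg hj.symm, mul_zero])
        (by simp), hreprI] at h2
  have hm0 : m i ≠ 0 := by
    rintro h
    rw [h] at h1
    simp at h1
  have hm1 : (1 : ℝ) ≤ |(m i : ℝ)| := by exact_mod_cast Int.one_le_abs hm0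
  have h2 : |(m i : ℝ)| * |B.repr (D.uR k) i| = 1 := by rw [← abs_mul, h1, abs_one]
  nlinarith [abs_nonneg (B.repr (D.uR k) i)]

theorem FlatsUnimodular.exists_norm_uR_le {D : Data n L} (hD : D.FlatsUnimodular) :
    ∃ C, ∀ k, ‖D.uR k‖ ≤ C := by
  obtain ⟨κ, hκ⟩ := D.exists_linearIndependent_uR
  let B := basisOfLinearIndependentOfCardEqFinrank' _ hκ (by simp)
  have hB : ∀ i, B i = D.uR (κ i) := fun i => by simp [B]
  refine ⟨∑ i, ‖B i‖, fun k => ?_⟩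
  rw [← B.sum_repr (D.uR k)]
  refine (norm_sum_le _ _).trans (Finset.sum_le_sum fun i _ => ?_)
  rw [norm_smul]
  exact mul_le_of_le_one_left (norm_nonneg _) (hD.abs_repr_le B hB k i)

/-- If the `u_k` are bounded, then `t ↦ ∑ t_k u_k` converges and is continuous, because
`∑ |t_k| ≤ ‖t‖ (∑ (1 + |λ_k|)⁻¹)^(1/2)`. -/
theorem nonempty_beta_of_norm_uR_le {C : ℝ} (hC : ∀ k, ‖D.uR k‖ ≤ C) : Nonempty D.Beta := by
  classical
  set A := √(∑' k, (1 + ‖D.lam k‖)⁻¹) with hA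
  have hgrowth : Summable fun k => (1 + ‖D.lam k‖)⁻¹ := D.growth
  have hA2 : HasSum (fun k => (√((1 + ‖D.lam k‖)⁻¹)) ^ 2) (A ^ 2) := by
    rw [hA, Real.sq_sqrt (tsum_nonneg fun k => by positivity)]
    exact hgrowth.hasSum.congr_fun fun k => Real.sq_sqrt (by positivity)
  have habs : ∀ t : D.LieT, ∃ S, S ≤ ‖t‖ * A ∧ HasSum (fun k => |D.coord t k|) S := fun t => by
    have ht : HasSum (fun k => (√(1 + ‖D.lam k‖) * |D.coord t k|) ^ 2) (‖t‖ ^ 2) :=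
      (D.hasSum_norm_lieT_sq t).congr_fun fun k => by
        rw [mul_pow, sq_abs, Real.sq_sqrt (by positivity)]
    obtain ⟨S, hS, h⟩ := exists_hasSum_mul_le (fun k => by positivity) (fun k => by positivity)
      (norm_nonneg t) (Real.sqrt_nonneg _) ht hA2
    refine ⟨S, hS, h.congr_fun fun k => ?_⟩
    have h1 : √(1 + ‖D.lam k‖) ≠ 0 := (Real.sqrt_pos.2 (by positivity)).ne'
    rw [Real.sqrt_inv]
    field_simp
  have hbound : ∀ (t : D.LieT) k, ‖D.coord t k • D.uR k‖ ≤ |D.coord t k| * C := fun t k => by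
    rw [norm_smul, Real.norm_eq_abs]
    exact mul_le_mul_of_nonneg_left (hC k) (abs_nonneg _)
  have hsum : ∀ t : D.LieT, Summable fun k => D.coord t k • D.uR k := fun t => by
    obtain ⟨S, -, h⟩ := habs t
    exact Summable.of_norm_bounded (h.summable.mul_right C) (hbound t)
  let f : D.LieT →ₗ[ℝ] (Fin n → ℝ) :=
    { toFun := fun t => ∑' k, D.coord t k • D.uR k
      map_add' := fun s t => by
        rw [← (hsum s).tsum_add (hsum t)]
        exact tsum_congr fun k => by rw [map_add, Pi.add_apply, add_smul]
      map_smul' := fun c t => by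
        rw [RingHom.id_apply, ← (hsum t).tsum_const_smul c]
        exact tsum_congr fun k => by rw [map_smul, Pi.smul_apply, smul_eq_mul, mul_smul] }
  refine ⟨⟨f.mkContinuous (A * |C|) fun t => ?_, fun k => ?_⟩⟩
  · obtain ⟨S, hS, h⟩ := habs t
    calc ‖f t‖ ≤ S * |C| := tsum_of_norm_bounded (h.mul_right |C|) fun k =>
          (hbound t k).trans (mul_le_mul_of_nonneg_left (le_abs_self C) (abs_nonneg _))
      _ ≤ ‖t‖ * A * |C| := mul_le_mul_of_nonneg_right hS (abs_nonneg C)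
      _ = _ := by ring
  · change ∑' j, D.coord (D.e k) j • D.uR j = _
    rw [tsum_eq_single k]
    · simp [coord_e]
    · intro j hj
      simp [coord_e, hj]

end Data

end Hypertoric

theorem mainTheorem4 {n : ℕ} {L : Type*} [Countable L] (D : Hypertoric.Data n L) :
    (D.FlatsUnimodular → Nonempty D.Beta) ∧
    ∀ b : D.Beta,
      (∃ Φ : b.OrbitSpace ≃ₜ Hypertoric.Data.Target n,
        ∀ p : b.M, Φ (Quotient.mk (MulAction.orbitRel (Hypertoric.Torus n) b.M) p) = b.phi p) ∧
      Nonempty (Hypertoric.Data.Target n ≃L[ℝ] EuclideanSpace ℝ (Fin (3 * n))) ∧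
      ConnectedSpace b.M ∧
      ∀ p : b.M,
        Hypertoric.IsSubtorus (MulAction.stabilizer (Hypertoric.Torus n) p) ∧
        Hypertoric.lieAlgebra (MulAction.stabilizer (Hypertoric.Torus n) p) =
          (Submodule.span ℝ {v | ∃ k, b.phi p ∈ D.flat k ∧ v = D.uR k} : Set (Fin n → ℝ)) := by
  refine ⟨fun hD => ?_, fun b => ⟨⟨b.orbitHomeomorph, fun p => rfl⟩,
    Hypertoric.nonempty_continuousLinearMap_equiv n 3 Hypertoric.imHEquiv, b.connectedSpace_M,
    fun p => ⟨b.isSubtorus_stabilizer p, b.lieAlgebra_stabilizer p⟩⟩⟩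
  obtain ⟨C, hC⟩ := hD.exists_norm_uR_le
  exact D.nonempty_beta_of_norm_uR_le hC
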